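/- **Setting.** Let $\mathbb S^1=\mathbb R/2\pi\mathbb Z$, and let $\mathcal E$ be the shift, $(\mathcal E a)(n)=a(n+1)$. Formal operators $\sum_{j\le r}a_j(n,y)\mathcal E^j$, $(n,y)\in\mathbb Z\times\mathbb S^1$, are multiplied by the rule $\mathcal E^ja=(\mathcal E^ja)\mathcal E^j$. For $A=\sum_j a_j\mathcal E^j$ put $A_+=\sum_{j\ge0}a_j\mathcal E^j$, $A_0=a_0$, $A_{>0}=A_+-A_0$, $A^*=\sum_j\mathcal E^{-j}a_j$, and let $$(A,B)=\int_0^{2\pi}\sum_{n\in\mathbb Z}(AB)_0\,dy,\qquad \langle u,v\rangle=\int_0^{2\pi}\sum_{n\in\mathbb Z}uv\,dy .$$ Fix $m\ge1$, $N\ge0$, $c\in\mathbb C$. Let $\hat{\mathcal G}^*$ be the set of operators $l=\mathcal E^m+\sum_{j<m}a_j\mathcal E^j$ with $a_j\in C^\infty(\mathbb S^1;\mathcal S(\mathbb Z;\mathbb C))$; here $c$ is the (constant) central component, so these are points of the level $c$ of $\hat{\mathcal G}^*_c$, and $[l-c\,\partial/\partial y,A]=[l,A]-c\,\partial A/\partial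 y$. Let $\bar W$ be the set of elements of $L_2(\mathbb Z\times\mathbb S^1;\mathbb C)$ that are smooth in $y$ with $y$-derivatives of at most polynomial growth in $n$. The extended phase space $\mathcal P\subset\hat{\mathcal G}^*_c\oplus\bar W^{2N}$ consists of the triples $(l,\mathrm f,\mathrm f^*)$, $l\in\hat{\mathcal G}^*$, $f_i,f_i^*\in\bar W$ ($1\le i\le N$), for which the coefficients of $\sum_{i=1}^N f_i\,\mathcal E(\mathcal E-1)^{-1}f_i^*$ lie in $C^\infty(\mathbb S^1;\mathcal S(\mathbb Z;\mathbb C))$, where $f\,\mathcal E(\mathcal E-1)^{-1}g=\sum_{k\ge0}f\,(\mathcal E^{-k}g)\,\mathcal E^{-k}$. Functionals are smooth if they are smooth along all smooth curves of variations with coefficients in $C^\infty(\mathbb S^1;\mathcal S(\mathbb Z;\mathbb C))$ (those of $l$ having order $<m$) and have gradients: $\delta\gamma=(\delta\gamma/\delta l,\delta l)+\sum_i\big(\langle\delta\gamma/\delta f_i,\delta f_i\rangle+\langle\delta\gamma/\delta f_i^*,\delta f_i^*\rangle\big)$ along such curves, where the gradients have coefficients smooth in $y$ with $y$-derivatives of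 at most polynomial growth in $n$. Let $\gamma$ be a Casimir functional, that is, a smooth functional on $\hat{\mathcal G}^*$ with a gradient $\nabla\gamma$ such that $[l-c\,\partial/\partial y,\nabla\gamma(l)]=0$ for all $l$ (for instance any member $\gamma_n$ of a hierarchy of Casimir functionals, with $t=t_n$). Consider the Bäcklund transformation $$B:(\tilde l,\tilde{\mathrm f},\tilde{\mathrm f}^*)\mapsto\Big(l=\tilde l+\sum_{i=1}^N f_i\,\mathcal E(\mathcal E-1)^{-1}f_i^*,\ \mathrm f=\tilde{\mathrm f},\ \mathrm f^*=\tilde{\mathrm f}^*\Big),$$ the Poisson structure $\tilde\Theta(r,\chi,\rho)=\big([\tilde l-c\,\partial/\partial y,r_+]-[\tilde l-c\,\partial/\partial y,r]_{>0},\,-\rho,\,\chi\big)$ at $(\tilde l,\tilde{\mathrm f},\tilde{\mathrm f}^*)$, and its transform $\Theta=B'\tilde\Theta B'^*$, where $$B'(h,\alpha,\beta)=\Big(h+\sum_i\big(\alpha_i\mathcal E(\mathcal E-1)^{-1}f_i^*+f_i\mathcal E(\mathcal E-1)^{-1}\beta_i\big),\alpha,\beta\Big),\qquad B'^*(r,\chi,\rho)=\big(r,\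 \chi+r_+^*\mathrm f^*,\ \rho+r_+\mathrm f\big),\qquad r_+^*:=(r_+)^* .$$ **Theorem 5.** The map $B$ is a bijection of $\mathcal P$ onto itself, with derivative $B'$ and conjugate $B'^*$. A gradient of $(l,\mathrm f,\mathrm f^*)\mapsto\gamma(l)$ is $(\nabla\gamma(l),0,0)$. The functional $\bar\gamma:=\gamma|_{l=l(\tilde l,\tilde{\mathrm f},\tilde{\mathrm f}^*)}$ on $\mathcal P$ is smooth, and a gradient of it is $\big(\nabla\gamma(l),\,(\nabla\gamma(l))_+^*\mathrm f^*,\,(\nabla\gamma(l))_+\mathrm f\big)$. Let $t\mapsto(\tilde l,\tilde{\mathrm f},\tilde{\mathrm f}^*)(t)$, $t\in J\subset\mathbb R$, be any curve in $\mathcal P$ and $(l,\mathrm f,\mathrm f^*)$ its image under $B$. With time derivatives taken coefficientwise at every $(n,y)$, and with any choice of the gradients of $\gamma$ (as a functional of $(l,\mathrm f,\mathrm f^*)$) and $\bar\gamma$ in (i) and (iii), the following are equivalent: (i) $\dfrac{d}{dt}(l,\mathrm f,\mathrm f^*)^\top=-\Theta\,\nabla\gamma(l,\mathrm f,\mathrm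 f^*)$ on $J$; (ii) $\dfrac{dl}{dt}=[(\nabla\gamma(l))_+,\,l-c\,\partial/\partial y]$, $\ \dfrac{df_i}{dt}=(\nabla\gamma(l))_+f_i$, $\ \dfrac{df_i^*}{dt}=-(\nabla\gamma(l))_+^*f_i^*$ on $J$; (iii) with $\nabla\bar\gamma(\tilde l):=\delta\bar\gamma/\delta\tilde l$, on $J$, $$\frac{d\tilde l}{dt}=[(\nabla\bar\gamma(\tilde l))_+,\tilde l]-[\nabla\bar\gamma(\tilde l),\tilde l]_{>0}+c\,\frac{\partial}{\partial y}(\nabla\bar\gamma(\tilde l))_0,\qquad \frac{d\tilde{\mathrm f}}{dt}=\frac{\delta\bar\gamma}{\delta\tilde{\mathrm f}^*},\qquad \frac{d\tilde{\mathrm f}^*}{dt}=-\frac{\delta\bar\gamma}{\delta\tilde{\mathrm f}} .$$ -/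

import Mathlib

namespace ShiftLax

open scoped ContDiff

/-! ### Functions on `ℤ × 𝕊¹` and formal shift operators -/

/-- Functions of a lattice variable `n : ℤ` and a real variable `y`; functions on
`𝕊¹ = ℝ / 2πℤ` are `2π`-periodic functions of `y`. -/
abbrev LatticeFun := ℤ → ℝ → ℂ

/-- Formal operators `∑ⱼ aⱼ ℰʲ`: the value `A j n y` is the coefficient `aⱼ(n, y)`.
All operators considered below have order bounded above, that is `aⱼ = 0` for large `j`. -/
abbrev ShiftOp := ℤ → LatticeFun

/-- Product of formal operators, from the rule `ℰⁱ b = (ℰⁱ b) ℰⁱ`, `(ℰⁱ b)(n) = b(n + i)`.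
For operators of order bounded above the sum is finite. -/
noncomputable def comp (A B : ShiftOp) : ShiftOp :=
  fun k n y => ∑ᶠ i : ℤ, A i n y * B (k - i) (n + i) y

/-- `[A, B] = AB - BA`. -/
noncomputable def comm (A B : ShiftOp) : ShiftOp := comp A B - comp B A

/-- `∂A/∂y`, coefficientwise. -/
noncomputable def dy (A : ShiftOp) : ShiftOp := fun j n y => deriv (A j n) y

/-- `[l - c ∂/∂y, A] = [l, A] - c ∂A/∂y`. -/
noncomputable def centralComm (c : ℂ) (l A : ShiftOp) : ShiftOp := comm l A - c • dy A

/-- `A₊ = ∑_{j ≥ 0} aⱼ ℰʲ`. -/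
def plusPart (A : ShiftOp) : ShiftOp := fun j n y => if 0 ≤ j then A j n y else 0

/-- `A₀ = a₀`, as an operator of order zero. -/
def zeroPart (A : ShiftOp) : ShiftOp := fun j n y => if j = 0 then A j n y else 0

/-- `A_{>0} = A₊ - A₀`. -/
def strictPart (A : ShiftOp) : ShiftOp := plusPart A - zeroPart A

/-- The action `(A f)(n) = ∑ⱼ aⱼ(n) f(n + j)`, used for operators with finitely many terms. -/
noncomputable def act (A : ShiftOp) (f : LatticeFun) : LatticeFun :=
  fun n y => ∑ᶠ j : ℤ, A j n y * f (n + j) y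

/-- The formal adjoint `A* = ∑ⱼ ℰ⁻ʲ aⱼ`. -/
def adj (A : ShiftOp) : ShiftOp := fun k n y => A (-k) (n + k) y

/-- The operator `f ℰ(ℰ - 1)⁻¹ g = ∑_{k ≥ 0} f · (ℰ⁻ᵏ g) ℰ⁻ᵏ`, where
`ℰ(ℰ - 1)⁻¹ = 1 + ℰ⁻¹ + ℰ⁻² + ⋯`. -/
def dress (f g : LatticeFun) : ShiftOp :=
  fun j n y => if j ≤ 0 then f n y * g (n + j) y else 0

/-- `(A, B) = ∫₀^{2π} Tr(AB) dy`, `Tr A = ∑ₙ a₀(n)`. -/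
noncomputable def opPair (A B : ShiftOp) : ℂ :=
  ∫ y in (0 : ℝ)..(2 * Real.pi), ∑' n : ℤ, comp A B 0 n y

/-- `⟨u, v⟩ = ∫₀^{2π} ∑ₙ u v dy` (bilinear). -/
noncomputable def funPair (u v : LatticeFun) : ℂ :=
  ∫ y in (0 : ℝ)..(2 * Real.pi), ∑' n : ℤ, u n y * v n y

/-! ### Function classes -/

/-- Smooth in `y ∈ 𝕊¹`. -/
def IsSmoothPeriodic (a : LatticeFun) : Prop :=
  ∀ n, ContDiff ℝ ∞ (a n) ∧ Function.Periodic (a n) (2 * Real.pi)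

/-- `C^∞(𝕊¹; 𝒮(ℤ; ℂ))`. -/
def IsSchwartz (a : LatticeFun) : Prop :=
  IsSmoothPeriodic a ∧ ∀ k p : ℕ, ∃ C : ℝ, ∀ (n : ℤ) (y : ℝ),
    (1 + |(n : ℝ)|) ^ k * ‖iteratedDeriv p (a n) y‖ ≤ C

/-- Smooth in `y`, with `y`-derivatives of at most polynomial growth in `n`. -/
def IsTempered (a : LatticeFun) : Prop :=
  IsSmoothPeriodic a ∧ ∀ p : ℕ, ∃ (k : ℕ) (C : ℝ), ∀ (n : ℤ) (y : ℝ),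
    ‖iteratedDeriv p (a n) y‖ ≤ C * (1 + |(n : ℝ)|) ^ k

/-- Elements of `L₂(ℤ × 𝕊¹; ℂ)` that are smooth in `y`, with tempered `y`-derivatives. -/
def IsWave (f : LatticeFun) : Prop :=
  IsTempered f ∧
    MeasureTheory.MemLp (fun p : ℤ × ℝ => f p.1 p.2) 2
      ((MeasureTheory.Measure.count : MeasureTheory.Measure ℤ).prod
        (MeasureTheory.volume.restrict (Set.Ioc (0 : ℝ) (2 * Real.pi))))

/-- A smooth curve `t ↦ φ t` in the Fréchet space `C^∞(𝕊¹; 𝒮(ℤ; ℂ))`. -/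
def IsSmoothCurve (φ : ℝ → LatticeFun) : Prop :=
  (∀ n, ContDiff ℝ ∞ (fun q : ℝ × ℝ => φ q.1 n q.2)) ∧
  (∀ t n, Function.Periodic (φ t n) (2 * Real.pi)) ∧
  ∀ (T : ℝ) (k p : ℕ), ∃ C : ℝ, ∀ t, |t| ≤ T → ∀ (n : ℤ) (y : ℝ),
    (1 + |(n : ℝ)|) ^ k * ‖iteratedFDeriv ℝ p (fun q : ℝ × ℝ => φ q.1 n q.2) (t, y)‖ ≤ C

/-! ### The phase space of operators and its functionals -/

/-- Operators `ℰᵐ + ∑_{j < m} aⱼ ℰʲ` with `aⱼ ∈ C^∞(𝕊¹; 𝒮(ℤ; ℂ))`. -/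
def Ghat (m : ℕ) : Set ShiftOp :=
  {l | l m = 1 ∧ (∀ j : ℤ, (m : ℤ) < j → l j = 0) ∧ ∀ j : ℤ, j < m → IsSchwartz (l j)}

/-- Variations `δl = ∑_{j < m} hⱼ ℰʲ` of elements of `Ghat m`. -/
def IsOpTangent (m : ℕ) (h : ShiftOp) : Prop :=
  (∀ j : ℤ, (m : ℤ) ≤ j → h j = 0) ∧ ∀ j, IsSchwartz (h j)

/-- Smooth curves of variations. -/
def IsOpCurve (m : ℕ) (σ : ℝ → ShiftOp) : Prop :=
  (∀ t, ∀ j : ℤ, (m : ℤ) ≤ j → σ t j = 0) ∧ ∀ j, IsSmoothCurve (fun t => σ t j)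

/-- Admissible gradients: operators `∑_{j ≤ r} uⱼ ℰʲ` of some order `r` with tempered
coefficients, so that the pairing with every variation converges. -/
def IsOpCovector (A : ShiftOp) : Prop :=
  (∃ r : ℤ, ∀ j, r < j → A j = 0) ∧ ∀ j, IsTempered (A j)

/-- Velocity at time `t` of a curve of lattice functions. -/
noncomputable def vel (φ : ℝ → LatticeFun) (t : ℝ) : LatticeFun :=
  fun n y => deriv (fun s => φ s n y) t

/-- `A` is a gradient of `γ` at `l`: `δγ(l) = (A, δl)` along every smooth curve in `Ghat m`
that passes through `l`. -/
def IsOpGradientAt (m : ℕ) (γ : ShiftOp → ℂ) (l A : ShiftOp) : Prop :=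
  IsOpCovector A ∧ ∀ σ : ℝ → ShiftOp, IsOpCurve m σ → σ 0 = 0 →
    HasDerivAt (fun t => γ (l + σ t)) (opPair A (fun j => vel (fun t => σ t j) 0)) 0

/-- `γ` is smooth along smooth curves in `Ghat m` and has a gradient at every point. -/
def IsSmoothOpFunctional (m : ℕ) (γ : ShiftOp → ℂ) : Prop :=
  ∀ l ∈ Ghat m,
    (∀ σ : ℝ → ShiftOp, IsOpCurve m σ → ContDiff ℝ ∞ (fun t => γ (l + σ t))) ∧
    ∃ A, IsOpGradientAt m γ l A

/-- `γ` is a Casimir functional at central charge `c`: a smooth functional whose gradient `dγ`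
satisfies `[l - c ∂/∂y, dγ(l)] = 0`. (As `l` varies only in orders below `m`, the terms of `dγ(l)`
of order `≤ -m` are not seen by the pairing; `dγ` is a choice of them for which the relation
holds.) -/
structure IsCasimir (c : ℂ) (m : ℕ) (γ : ShiftOp → ℂ) (dγ : ShiftOp → ShiftOp) : Prop where
  smooth : IsSmoothOpFunctional m γ
  gradient : ∀ l ∈ Ghat m, IsOpGradientAt m γ l (dγ l)
  invariant : ∀ l ∈ Ghat m, centralComm c l (dγ l) = 0

/-! ### The extended phase space and its functionals -/

/-- Triples `(l, f, f*)`; also used for tangent vectors `(h, α, β)` and covectors `(r, χ, ρ)`. -/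
abbrev Triple (N : ℕ) := ShiftOp × (Fin N → LatticeFun) × (Fin N → LatticeFun)

/-- `∑ᵢ fᵢ ℰ(ℰ - 1)⁻¹ fᵢ*`. -/
def dressSum {N : ℕ} (f fs : Fin N → LatticeFun) : ShiftOp := ∑ i, dress (f i) (fs i)

/-- The extended phase space: `l` in `Ghat m` and `fᵢ, fᵢ*` in `L₂(ℤ × 𝕊¹; ℂ)`, smooth in `y`, such
that adding `∑ᵢ fᵢ ℰ(ℰ - 1)⁻¹ fᵢ*` to an element of `Ghat m` does not lead out of it. -/
def Phase (m N : ℕ) : Set (Triple N) :=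
  {x | x.1 ∈ Ghat m ∧ (∀ i, IsWave (x.2.1 i)) ∧ (∀ i, IsWave (x.2.2 i)) ∧
    ∀ j, IsSchwartz (dressSum x.2.1 x.2.2 j)}

/-- Variations `(δl, δf, δf*)`. -/
def IsTangent (m : ℕ) {N : ℕ} (v : Triple N) : Prop :=
  IsOpTangent m v.1 ∧ (∀ i, IsSchwartz (v.2.1 i)) ∧ ∀ i, IsSchwartz (v.2.2 i)

/-- Smooth curves of variations. -/
def IsCurve (m : ℕ) {N : ℕ} (σ : ℝ → Triple N) : Prop :=
  IsOpCurve m (fun t => (σ t).1) ∧ (∀ i, IsSmoothCurve (fun t => (σ t).2.1 i)) ∧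
    ∀ i, IsSmoothCurve (fun t => (σ t).2.2 i)

/-- Admissible gradients on the extended phase space. -/
def IsCovector {N : ℕ} (w : Triple N) : Prop :=
  IsOpCovector w.1 ∧ (∀ i, IsTempered (w.2.1 i)) ∧ ∀ i, IsTempered (w.2.2 i)

/-- `((r, χ, ρ), (h, α, β)) = (r, h) + ∑ᵢ (⟨χᵢ, αᵢ⟩ + ⟨ρᵢ, βᵢ⟩)`. -/
noncomputable def extPair {N : ℕ} (w v : Triple N) : ℂ :=
  opPair w.1 v.1 + ∑ i, (funPair (w.2.1 i) (v.2.1 i) + funPair (w.2.2 i) (v.2.2 i))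

/-- Velocity at time `t` of a curve of triples. -/
noncomputable def extVel {N : ℕ} (σ : ℝ → Triple N) (t : ℝ) : Triple N :=
  (fun j => vel (fun s => (σ s).1 j) t, fun i => vel (fun s => (σ s).2.1 i) t,
    fun i => vel (fun s => (σ s).2.2 i) t)

/-- `w = (δF/δl, δF/δf, δF/δf*)` is a gradient of `F` at `x`. -/
def IsGradientAt (m : ℕ) {N : ℕ} (F : Triple N → ℂ) (x w : Triple N) : Prop :=
  IsCovector w ∧ ∀ σ : ℝ → Triple N, IsCurve m σ → σ 0 = 0 →
    HasDerivAt (fun t => F (x + σ t)) (extPair w (extVel σ 0)) 0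

/-- Smooth functionals on the extended phase space. -/
def IsSmoothFunctional (m : ℕ) {N : ℕ} (F : Triple N → ℂ) : Prop :=
  ∀ x ∈ Phase m N,
    (∀ σ : ℝ → Triple N, IsCurve m σ → ContDiff ℝ ∞ (fun t => F (x + σ t))) ∧
    ∃ w, IsGradientAt m F x w

/-! ### The Bäcklund transformation and the Poisson structures -/

/-- `B(l̃, f, f*) = (l̃ + ∑ᵢ fᵢ ℰ(ℰ - 1)⁻¹ fᵢ*, f, f*)`. -/
def backlund {N : ℕ} (x : Triple N) : Triple N := (x.1 + dressSum x.2.1 x.2.2, x.2)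

/-- The inverse of `B`. -/
def backlundInv {N : ℕ} (z : Triple N) : Triple N := (z.1 - dressSum z.2.1 z.2.2, z.2)

/-- The derivative `B'` at a point with components `f`, `f*`. -/
def backlundDeriv {N : ℕ} (x v : Triple N) : Triple N :=
  (v.1 + ∑ i, (dress (v.2.1 i) (x.2.2 i) + dress (x.2.1 i) (v.2.2 i)), v.2)

/-- The conjugate operator `B'*`: `(r, χ, ρ) ↦ (r, χ + r₊* f*, ρ + r₊ f)`. -/
noncomputable def backlundConj {N : ℕ} (x w : Triple N) : Triple N :=
  (w.1, fun i => w.2.1 i + act (adj (plusPart w.1)) (x.2.2 i),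
    fun i => w.2.2 i + act (plusPart w.1) (x.2.1 i))

/-- `θ̃ : r ↦ [l̃ - c ∂/∂y, r₊] - [l̃ - c ∂/∂y, r]_{>0}` at the point `l̃`. -/
noncomputable def thetaOp (c : ℂ) (l r : ShiftOp) : ShiftOp :=
  centralComm c l (plusPart r) - strictPart (centralComm c l r)

/-- `Θ̃ = θ̃ ⊗ J̃`, `J̃(χ, ρ) = (-ρ, χ)`. -/
noncomputable def thetaTilde (c : ℂ) {N : ℕ} (x w : Triple N) : Triple N :=
  (thetaOp c x.1 w.1, -w.2.2, w.2.1)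

/-- The transformed Poisson structure `Θ = B' Θ̃ B'*` at the point `z = B(x)`. -/
noncomputable def theta (c : ℂ) {N : ℕ} (z w : Triple N) : Triple N :=
  backlundDeriv (backlundInv z)
    (thetaTilde c (backlundInv z) (backlundConj (backlundInv z) w))

/-! ### Evolution equations -/

/-- The curve `x` has velocity `v` at time `t` (relative to the time set `J`), coefficientwise. -/
def HasVelocity {N : ℕ} (J : Set ℝ) (x : ℝ → Triple N) (v : Triple N) (t : ℝ) : Prop :=
  (∀ j n y, HasDerivWithinAt (fun s => (x s).1 j n y) (v.1 j n y) J t) ∧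
  (∀ i n y, HasDerivWithinAt (fun s => (x s).2.1 i n y) (v.2.1 i n y) J t) ∧
  (∀ i n y, HasDerivWithinAt (fun s => (x s).2.2 i n y) (v.2.2 i n y) J t)

/-- Right-hand side of `dl/dt = [A₊, l - c ∂/∂y]`, `dfᵢ/dt = A₊ fᵢ`, `dfᵢ*/dt = -(A₊)* fᵢ*`. -/
noncomputable def laxField (c : ℂ) {N : ℕ} (A : ShiftOp) (z : Triple N) : Triple N :=
  (-centralComm c z.1 (plusPart A), fun i => act (plusPart A) (z.2.1 i),
    fun i => -act (adj (plusPart A)) (z.2.2 i))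

/-- Right-hand side of `dl̃/dt = [R₊, l̃] - [R, l̃]_{>0} + c ∂R₀/∂y`, `df̃/dt = ρ`, `df̃*/dt = -χ`
for a gradient `w = (R, χ, ρ)`. -/
noncomputable def transformedField (c : ℂ) {N : ℕ} (w x : Triple N) : Triple N :=
  (comm (plusPart w.1) x.1 - strictPart (comm w.1 x.1) + c • dy (zeroPart w.1),
    w.2.2, -w.2.1)

end ShiftLax

open ShiftLax

/-! Put D = ∑ fᵢ ℰ(ℰ - 1)⁻¹ fᵢ*, so that l = l̃ + D, and A = ∇γ(l). The map B is a shear: D depends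
only on the components that B does not move. Hence B is inverted by subtracting D, and a curve has
velocity v exactly when its image has velocity B'v (`hasVelocity_backlund_iff`).

(i) ⇔ (ii) is an equality of vector fields. Applying B'*, Θ̃, B' to (A, 0, 0) gives the function
components -A₊f, A₊*f* and the operator θ̃(A) + ∑ (fᵢ ℰ(ℰ - 1)⁻¹ (A₊*fᵢ*) - (A₊fᵢ) ℰ(ℰ - 1)⁻¹ fᵢ*).
The sum is the part of [D, A₊] of nonpositive order (`comm_dressSum`). The Casimir relation says [l̃
- c∂/∂y, A] = -[D, A], and since D has no positive orders, [D, A]_{>0} = [D, A₊]_{>0}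
(`strictPart_comm_plusPart`). So θ̃(A) = [l̃ - c∂/∂y, A₊] + [D, A₊]_{>0}, and the total is [l -
c∂/∂y, A₊] (`thetaOp_add_dress_eq_centralComm`).

(i) ⇔ (iii) is the chain rule: B'* applied to ∇γ is a gradient of γ̄, so the field in (iii) is
-Θ̃B'*∇γ, which B' carries to -Θ∇γ.

The choice of gradients is immaterial. Test variations determine their function components and their
operator coefficients in orders above -m (`IsGradientAt.snd_eq`, `IsGradientAt.coeff_eq`), and at an
operator of order m ≥ 1 neither A₊ nor θ̃(A) uses any other coefficient (`plusPart_congr`,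
`thetaOp_congr`).

The analysis rests on one fact: tempered times Schwartz is Schwartz, also along curves, so pairings
converge and B maps admissible curves to admissible curves. -/

namespace ShiftLax

open scoped ContDiff

/-! ### Growth bounds for sequences of smooth functions -/

section Bounds

variable {E : Type*} [NormedAddCommGroup E] [NormedSpace ℝ E]

/-- All derivatives are of at most polynomial growth in `n`, uniformly on `S`. -/
def PolyBound (S : Set E) (φ : ℤ → E → ℂ) : Prop :=
  ∀ p : ℕ, ∃ (k : ℕ) (C : ℝ), 0 ≤ C ∧ ∀ n : ℤ, ∀ x ∈ S,
    ‖iteratedFDeriv ℝ p (φ n) x‖ ≤ C * (1 + |(n : ℝ)|) ^ k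

/-- All derivatives decay faster than any power of `n`, uniformly on `S`. -/
def RapidBound (S : Set E) (φ : ℤ → E → ℂ) : Prop :=
  ∀ k p : ℕ, ∃ C : ℝ, 0 ≤ C ∧ ∀ n : ℤ, ∀ x ∈ S,
    (1 + |(n : ℝ)|) ^ k * ‖iteratedFDeriv ℝ p (φ n) x‖ ≤ C

variable {S : Set E} {φ ψ : ℤ → E → ℂ}

theorem one_le_weight (n : ℤ) : (1 : ℝ) ≤ 1 + |(n : ℝ)| := by
  linarith [abs_nonneg (n : ℝ)]

/-- Peetre's inequality: a shift by j costs only a constant factor, so decay and growth classes are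
shift invariant. -/
theorem weight_le_mul (n j : ℤ) :
    1 + |(n : ℝ)| ≤ (1 + |(j : ℝ)|) * (1 + |((n + j : ℤ) : ℝ)|) := by
  have h : |(n : ℝ)| ≤ |((n + j : ℤ) : ℝ)| + |(j : ℝ)| := by
    have := abs_sub ((n + j : ℤ) : ℝ) (j : ℝ)
    push_cast at this ⊢
    simpa using this
  nlinarith [abs_nonneg ((n + j : ℤ) : ℝ), abs_nonneg (j : ℝ)]

theorem weight_add_le_mul (n j : ℤ) :
    1 + |((n + j : ℤ) : ℝ)| ≤ (1 + |(j : ℝ)|) * (1 + |(n : ℝ)|) := by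
  have h : |((n + j : ℤ) : ℝ)| ≤ |(n : ℝ)| + |(j : ℝ)| := by
    push_cast
    exact abs_add_le _ _
  nlinarith [abs_nonneg (n : ℝ), abs_nonneg (j : ℝ)]

theorem RapidBound.polyBound (h : RapidBound S φ) : PolyBound S φ := fun p => by
  obtain ⟨C, hC, h⟩ := h 0 p
  exact ⟨0, C, hC, fun (n : ℤ) x hx => by simpa using h n x hx⟩

theorem RapidBound.add (hφ : ∀ n, ContDiff ℝ ∞ (φ n)) (hψ : ∀ n, ContDiff ℝ ∞ (ψ n))
    (h : RapidBound S φ) (h' : RapidBound S ψ) : RapidBound S (φ + ψ) := fun k p => by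
  obtain ⟨C, hC, h⟩ := h k p
  obtain ⟨C', hC', h'⟩ := h' k p
  refine ⟨C + C', by positivity, fun (n : ℤ) x hx => ?_⟩
  have e : iteratedFDeriv ℝ p ((φ + ψ) n) x
      = iteratedFDeriv ℝ p (φ n) x + iteratedFDeriv ℝ p (ψ n) x :=
    iteratedFDeriv_add_apply ((hφ n).of_le (by exact_mod_cast le_top)).contDiffAt
      ((hψ n).of_le (by exact_mod_cast le_top)).contDiffAt
  rw [e]
  calc _ ≤ (1 + |(n : ℝ)|) ^ k *
        (‖iteratedFDeriv ℝ p (φ n) x‖ + ‖iteratedFDeriv ℝ p (ψ n) x‖) := by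
        gcongr
        exact norm_add_le _ _
    _ ≤ C + C' := by rw [mul_add]; exact add_le_add (h n x hx) (h' n x hx)

theorem PolyBound.add (hφ : ∀ n, ContDiff ℝ ∞ (φ n)) (hψ : ∀ n, ContDiff ℝ ∞ (ψ n))
    (h : PolyBound S φ) (h' : PolyBound S ψ) : PolyBound S (φ + ψ) := fun p => by
  obtain ⟨k, C, hC, h⟩ := h p
  obtain ⟨k', C', hC', h'⟩ := h' p
  refine ⟨k + k', C + C', by positivity, fun (n : ℤ) x hx => ?_⟩
  have e : iteratedFDeriv ℝ p ((φ + ψ) n) x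
      = iteratedFDeriv ℝ p (φ n) x + iteratedFDeriv ℝ p (ψ n) x :=
    iteratedFDeriv_add_apply ((hφ n).of_le (by exact_mod_cast le_top)).contDiffAt
      ((hψ n).of_le (by exact_mod_cast le_top)).contDiffAt
  rw [e, add_mul]
  refine (norm_add_le _ _).trans (add_le_add ((h n x hx).trans ?_) ((h' n x hx).trans ?_))
  · gcongr
    · exact one_le_weight n
    · omega
  · gcongr
    · exact one_le_weight n
    · omega

theorem RapidBound.mul (hφ : ∀ n, ContDiff ℝ ∞ (φ n)) (hψ : ∀ n, ContDiff ℝ ∞ (ψ n))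
    (h : PolyBound S φ) (h' : RapidBound S ψ) :
    RapidBound S (fun n x => φ n x * ψ n x) := fun k p => by
  choose a C hC h using h
  choose C' hC' h' using h'
  -- In the Leibniz sum the growth exponent `a i` of the i-th derivative of φ is absorbed by asking
  -- for the larger weight `k + a i` on ψ.
  refine ⟨∑ i ∈ Finset.range (p + 1), (p.choose i : ℝ) * C i * C' (k + a i) (p - i),
    Finset.sum_nonneg fun i _ => by have := hC i; have := hC' (k + a i) (p - i); positivity,
    fun (n : ℤ) x hx => ?_⟩
  have hw : (0 : ℝ) ≤ 1 + |(n : ℝ)| := by positivity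
  refine (mul_le_mul_of_nonneg_left (norm_iteratedFDeriv_mul_le (hφ n) (hψ n) x
    (by exact_mod_cast le_top)) (by positivity)).trans ?_
  rw [Finset.mul_sum]
  refine Finset.sum_le_sum fun i _ => ?_
  calc _ ≤ (1 + |(n : ℝ)|) ^ k * ((p.choose i : ℝ) * (C i * (1 + |(n : ℝ)|) ^ a i)
          * ‖iteratedFDeriv ℝ (p - i) (ψ n) x‖) := by
        gcongr
        exact h i n x hx
    _ = (p.choose i : ℝ) * C i *
          ((1 + |(n : ℝ)|) ^ (k + a i) * ‖iteratedFDeriv ℝ (p - i) (ψ n) x‖) := by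
        rw [pow_add]; ring
    _ ≤ _ := by
        have := hC i
        gcongr
        exact h' _ _ n x hx

theorem PolyBound.mul (hφ : ∀ n, ContDiff ℝ ∞ (φ n)) (hψ : ∀ n, ContDiff ℝ ∞ (ψ n))
    (h : PolyBound S φ) (h' : PolyBound S ψ) :
    PolyBound S (fun n x => φ n x * ψ n x) := fun p => by
  choose a C hC h using h
  choose a' C' hC' h' using h'
  -- The sum of the exponents serves as a common bound for the exponents of all Leibniz terms.
  refine ⟨∑ i ∈ Finset.range (p + 1), (a i + a' (p - i)),
    ∑ i ∈ Finset.range (p + 1), (p.choose i : ℝ) * C i * C' (p - i),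
    Finset.sum_nonneg fun i _ => by have := hC i; have := hC' (p - i); positivity,
    fun (n : ℤ) x hx => ?_⟩
  have hw : (0 : ℝ) ≤ 1 + |(n : ℝ)| := by positivity
  refine (norm_iteratedFDeriv_mul_le (hφ n) (hψ n) x (by exact_mod_cast le_top)).trans ?_
  rw [Finset.sum_mul]
  refine Finset.sum_le_sum fun i hi => ?_
  have := hC i
  have := hC' (p - i)
  calc _ ≤ (p.choose i : ℝ) * (C i * (1 + |(n : ℝ)|) ^ a i)
          * (C' (p - i) * (1 + |(n : ℝ)|) ^ a' (p - i)) := by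
        gcongr
        · exact h i n x hx
        · exact h' _ n x hx
    _ = (p.choose i : ℝ) * C i * C' (p - i) * (1 + |(n : ℝ)|) ^ (a i + a' (p - i)) := by
        rw [pow_add]; ring
    _ ≤ _ := by
        gcongr
        · exact one_le_weight n
        · exact Finset.single_le_sum (f := fun i => a i + a' (p - i)) (fun _ _ => Nat.zero_le _) hi

theorem RapidBound.shift (h : RapidBound S φ) (j : ℤ) :
    RapidBound S (fun n => φ (n + j)) := fun k p => by
  obtain ⟨C, hC, h⟩ := h k p
  refine ⟨(1 + |(j : ℝ)|) ^ k * C, by positivity, fun (n : ℤ) x hx => ?_⟩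
  calc _ ≤ ((1 + |(j : ℝ)|) * (1 + |((n + j : ℤ) : ℝ)|)) ^ k
          * ‖iteratedFDeriv ℝ p (φ (n + j)) x‖ := by
        gcongr
        exact weight_le_mul n j
    _ ≤ _ := by
        rw [mul_pow, mul_assoc]
        gcongr
        exact h _ x hx

theorem PolyBound.shift (h : PolyBound S φ) (j : ℤ) :
    PolyBound S (fun n => φ (n + j)) := fun p => by
  obtain ⟨k, C, hC, h⟩ := h p
  refine ⟨k, C * (1 + |(j : ℝ)|) ^ k, by positivity, fun (n : ℤ) x hx => (h _ x hx).trans ?_⟩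
  rw [mul_assoc, ← mul_pow]
  gcongr
  exact weight_add_le_mul n j

/-- Composition with a linear map of norm at most one does not increase derivatives. -/
theorem norm_iteratedFDeriv_comp_le_of_norm_le_one {G : Type*} [NormedAddCommGroup G]
    [NormedSpace ℝ G] {F : Type*} [NormedAddCommGroup F] [NormedSpace ℝ F]
    (L : G →L[ℝ] E) (hL : ‖L‖ ≤ 1) {f : E → F} (hf : ContDiff ℝ ∞ f) (x : G) (p : ℕ) :
    ‖iteratedFDeriv ℝ p (fun x => f (L x)) x‖ ≤ ‖iteratedFDeriv ℝ p f (L x)‖ := by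
  have e := L.iteratedFDeriv_comp_right hf x (i := p) (by exact_mod_cast le_top)
  change ‖iteratedFDeriv ℝ p (f ∘ L) x‖ ≤ _
  rw [e]
  refine (ContinuousMultilinearMap.norm_compContinuousLinearMap_le _ _).trans ?_
  refine mul_le_of_le_one_right (norm_nonneg _) ?_
  exact Finset.prod_le_one (fun _ _ => norm_nonneg _) fun _ _ => hL

theorem PolyBound.comp {G : Type*} [NormedAddCommGroup G] [NormedSpace ℝ G] {T : Set G}
    (L : G →L[ℝ] E) (hL : ‖L‖ ≤ 1) (hT : ∀ x ∈ T, L x ∈ S) (hφ : ∀ n, ContDiff ℝ ∞ (φ n))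
    (h : PolyBound S φ) : PolyBound T (fun n x => φ n (L x)) := fun p => by
  obtain ⟨k, C, hC, h⟩ := h p
  exact ⟨k, C, hC, fun (n : ℤ) x hx =>
    (norm_iteratedFDeriv_comp_le_of_norm_le_one L hL (hφ n) x p).trans (h n _ (hT x hx))⟩

theorem RapidBound.comp {G : Type*} [NormedAddCommGroup G] [NormedSpace ℝ G] {T : Set G}
    (L : G →L[ℝ] E) (hL : ‖L‖ ≤ 1) (hT : ∀ x ∈ T, L x ∈ S) (hφ : ∀ n, ContDiff ℝ ∞ (φ n))
    (h : RapidBound S φ) : RapidBound T (fun n x => φ n (L x)) := fun k p => by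
  obtain ⟨C, hC, h⟩ := h k p
  exact ⟨C, hC, fun (n : ℤ) x hx => (mul_le_mul_of_nonneg_left
    (norm_iteratedFDeriv_comp_le_of_norm_le_one L hL (hφ n) x p) (by positivity)).trans
      (h n _ (hT x hx))⟩

/-- Evaluation at v is linear of norm at most one, so derivatives of order p here are controlled by
those of order p + 1 of φ. It is used for the time derivative of a curve. -/
theorem RapidBound.fderiv_apply (h : RapidBound S φ) (hφ : ∀ n, ContDiff ℝ ∞ (φ n)) (v : E)
    (hv : ‖v‖ ≤ 1) : RapidBound S (fun n x => fderiv ℝ (φ n) x v) := fun k p => by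
  obtain ⟨C, hC, h⟩ := h k (p + 1)
  refine ⟨C, hC, fun (n : ℤ) x hx => le_trans (mul_le_mul_of_nonneg_left ?_ (by positivity)) (h n x hx)⟩
  have hd : ContDiff ℝ ∞ (fderiv ℝ (φ n)) := (hφ n).fderiv_right (by simp)
  have := (ContinuousLinearMap.apply ℝ ℂ v).norm_iteratedFDeriv_comp_left (x := x)
    hd.contDiffAt (n := p) (by exact_mod_cast le_top)
  refine (this.trans ?_).trans_eq (norm_iteratedFDeriv_fderiv (n := p))
  refine mul_le_of_le_one_left (norm_nonneg _) ?_
  refine ContinuousLinearMap.opNorm_le_bound _ zero_le_one fun T => ?_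
  rw [ContinuousLinearMap.apply_apply, one_mul]
  exact (T.le_opNorm v).trans (mul_le_of_le_one_right (norm_nonneg _) hv)

end Bounds

/-! ### Closure properties of the function classes -/

section Classes

variable {a b : LatticeFun}

theorem isTempered_iff : IsTempered a ↔ IsSmoothPeriodic a ∧ PolyBound Set.univ a := by
  refine and_congr_right fun _ => forall_congr' fun p => exists_congr fun k => ?_
  constructor
  · rintro ⟨C, h⟩
    refine ⟨max C 0, le_max_right _ _, fun n y _ => ?_⟩
    rw [norm_iteratedFDeriv_eq_norm_iteratedDeriv]
    exact (h n y).trans (by gcongr; exact le_max_left _ _)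
  · rintro ⟨C, _, h⟩
    refine ⟨C, fun n y => ?_⟩
    rw [← norm_iteratedFDeriv_eq_norm_iteratedDeriv]
    exact h n y trivial

theorem isSchwartz_iff : IsSchwartz a ↔ IsSmoothPeriodic a ∧ RapidBound Set.univ a := by
  refine and_congr_right fun _ => forall_congr' fun k => forall_congr' fun p => ?_
  constructor
  · rintro ⟨C, h⟩
    refine ⟨max C 0, le_max_right _ _, fun n y _ => ?_⟩
    rw [norm_iteratedFDeriv_eq_norm_iteratedDeriv]
    exact (h n y).trans (le_max_left _ _)
  · rintro ⟨C, _, h⟩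
    refine ⟨C, fun n y => ?_⟩
    rw [← norm_iteratedFDeriv_eq_norm_iteratedDeriv]
    exact h n y trivial

theorem IsSmoothPeriodic.mul (ha : IsSmoothPeriodic a) (hb : IsSmoothPeriodic b) :
    IsSmoothPeriodic (fun n y => a n y * b n y) := fun n =>
  ⟨(ha n).1.mul (hb n).1, (ha n).2.mul (hb n).2⟩

theorem IsSmoothPeriodic.add (ha : IsSmoothPeriodic a) (hb : IsSmoothPeriodic b) :
    IsSmoothPeriodic (a + b) := fun n =>
  ⟨(ha n).1.add (hb n).1, (ha n).2.add (hb n).2⟩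

theorem IsSmoothPeriodic.shift (ha : IsSmoothPeriodic a) (j : ℤ) :
    IsSmoothPeriodic (fun n => a (n + j)) := fun n => ha (n + j)

theorem IsSmoothPeriodic.const (C : ℂ) : IsSmoothPeriodic (fun _ _ => C) := fun _ =>
  ⟨contDiff_const, fun _ => rfl⟩

theorem IsSchwartz.isTempered (ha : IsSchwartz a) : IsTempered a :=
  isTempered_iff.2 ⟨ha.1, (isSchwartz_iff.1 ha).2.polyBound⟩

theorem IsTempered.mul (ha : IsTempered a) (hb : IsTempered b) :
    IsTempered (fun n y => a n y * b n y) :=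
  isTempered_iff.2 ⟨ha.1.mul hb.1, (isTempered_iff.1 ha).2.mul (fun n => (ha.1 n).1)
    (fun n => (hb.1 n).1) (isTempered_iff.1 hb).2⟩

theorem IsTempered.mul_isSchwartz (ha : IsTempered a) (hb : IsSchwartz b) :
    IsSchwartz (fun n y => a n y * b n y) :=
  isSchwartz_iff.2 ⟨ha.1.mul hb.1, .mul (fun n => (ha.1 n).1)
    (fun n => (hb.1 n).1) (isTempered_iff.1 ha).2 (isSchwartz_iff.1 hb).2⟩

theorem IsTempered.add (ha : IsTempered a) (hb : IsTempered b) : IsTempered (a + b) :=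
  isTempered_iff.2 ⟨ha.1.add hb.1, (isTempered_iff.1 ha).2.add (fun n => (ha.1 n).1)
    (fun n => (hb.1 n).1) (isTempered_iff.1 hb).2⟩

theorem IsSchwartz.add (ha : IsSchwartz a) (hb : IsSchwartz b) : IsSchwartz (a + b) :=
  isSchwartz_iff.2 ⟨ha.1.add hb.1, (isSchwartz_iff.1 ha).2.add (fun n => (ha.1 n).1)
    (fun n => (hb.1 n).1) (isSchwartz_iff.1 hb).2⟩

theorem IsTempered.shift (ha : IsTempered a) (j : ℤ) : IsTempered (fun n => a (n + j)) :=
  isTempered_iff.2 ⟨ha.1.shift j, (isTempered_iff.1 ha).2.shift j⟩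

theorem IsSchwartz.shift (ha : IsSchwartz a) (j : ℤ) : IsSchwartz (fun n => a (n + j)) :=
  isSchwartz_iff.2 ⟨ha.1.shift j, (isSchwartz_iff.1 ha).2.shift j⟩

theorem isTempered_const (C : ℂ) : IsTempered (fun _ _ => C) := by
  refine isTempered_iff.2 ⟨.const C, fun p => ⟨0, ‖C‖, norm_nonneg C, fun n y _ => ?_⟩⟩
  rcases eq_or_ne p 0 with rfl | hp
  · simp
  · simp [iteratedFDeriv_const_of_ne hp]

theorem isSchwartz_zero : IsSchwartz 0 := by
  refine isSchwartz_iff.2 ⟨.const 0, fun k p => ⟨0, le_rfl, fun n y _ => ?_⟩⟩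
  simp [Pi.zero_def, iteratedFDeriv_fun_zero]

theorem isTempered_zero : IsTempered 0 := isSchwartz_zero.isTempered

theorem IsSchwartz.neg (ha : IsSchwartz a) : IsSchwartz (-a) := by
  have := (isTempered_const (-1)).mul_isSchwartz ha
  convert this using 3
  simp

theorem IsTempered.neg (ha : IsTempered a) : IsTempered (-a) := by
  have := (isTempered_const (-1)).mul ha
  convert this using 3
  simp

theorem IsTempered.sub (ha : IsTempered a) (hb : IsTempered b) : IsTempered (a - b) := by
  rw [sub_eq_add_neg]
  exact ha.add hb.neg

theorem IsSchwartz.sum {ι : Type*} {s : Finset ι} {a : ι → LatticeFun}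
    (h : ∀ i ∈ s, IsSchwartz (a i)) : IsSchwartz (∑ i ∈ s, a i) :=
  Finset.sum_induction a IsSchwartz (fun _ _ => .add) isSchwartz_zero h

theorem IsTempered.sum {ι : Type*} {s : Finset ι} {a : ι → LatticeFun}
    (h : ∀ i ∈ s, IsTempered (a i)) : IsTempered (∑ i ∈ s, a i) :=
  Finset.sum_induction a IsTempered (fun _ _ => .add) isTempered_zero h

/-- The part of a tempered function at a single lattice site, complex conjugated. -/
theorem IsTempered.isSchwartz_conj_single (ha : IsTempered a) (n₀ n₁ : ℤ) :
    IsSchwartz (fun n y => if n = n₁ then starRingEnd ℂ (a n₀ y) else 0) := by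
  refine isSchwartz_iff.2 ⟨fun n => ?_, fun k p => ?_⟩
  · rcases eq_or_ne n n₁ with rfl | hn
    · simp only [if_true]
      refine ⟨Complex.conjCLE.contDiff.comp (ha.1 n₀).1, fun y => congrArg _ ((ha.1 n₀).2 y)⟩
    · simp only [if_neg hn]
      exact ⟨contDiff_const, fun _ => rfl⟩
  · obtain ⟨K, C, hC, h⟩ := (isTempered_iff.1 ha).2 p
    refine ⟨(1 + |(n₁ : ℝ)|) ^ k * (C * (1 + |(n₀ : ℝ)|) ^ K), by positivity,
      fun (n : ℤ) y _ => ?_⟩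
    rcases eq_or_ne n n₁ with rfl | hn
    · simp only [if_true]
      have := Complex.conjLIE.norm_iteratedFDeriv_comp_left (a n₀) y p
      refine mul_le_mul_of_nonneg_left ?_ (by positivity)
      exact this.trans_le (h n₀ y trivial)
    · simp only [if_neg hn, iteratedFDeriv_fun_zero]
      simp only [Pi.zero_apply, norm_zero, mul_zero]
      positivity

end Classes

/-! ### Curves -/

section Curves

/-- Smooth curves of tempered functions. -/
def IsTemperedCurve (φ : ℝ → LatticeFun) : Prop :=
  (∀ n, ContDiff ℝ ∞ (fun q : ℝ × ℝ => φ q.1 n q.2)) ∧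
  (∀ t n, Function.Periodic (φ t n) (2 * Real.pi)) ∧
  ∀ T : ℝ, PolyBound {q : ℝ × ℝ | |q.1| ≤ T} (fun n q => φ q.1 n q.2)

variable {φ ψ : ℝ → LatticeFun}

/-- The bounds are formulated over an arbitrary normed space so that the same calculus covers
functions of y and of (t, y). -/
theorem isSmoothCurve_iff : IsSmoothCurve φ ↔
    (∀ n, ContDiff ℝ ∞ (fun q : ℝ × ℝ => φ q.1 n q.2)) ∧
    (∀ t n, Function.Periodic (φ t n) (2 * Real.pi)) ∧
    ∀ T : ℝ, RapidBound {q : ℝ × ℝ | |q.1| ≤ T} (fun n q => φ q.1 n q.2) := by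
  refine and_congr_right fun _ => and_congr_right fun _ => forall_congr' fun T =>
    forall_congr' fun k => forall_congr' fun p => ?_
  constructor
  · rintro ⟨C, h⟩
    exact ⟨max C 0, le_max_right _ _, fun n q hq => (h q.1 hq n q.2).trans (le_max_left _ _)⟩
  · rintro ⟨C, _, h⟩
    exact ⟨C, fun t ht n y => h n (t, y) ht⟩

theorem IsSmoothCurve.isTemperedCurve (h : IsSmoothCurve φ) : IsTemperedCurve φ :=
  ⟨h.1, h.2.1, fun T => ((isSmoothCurve_iff.1 h).2.2 T).polyBound⟩

theorem IsTemperedCurve.mul_isSmoothCurve (h : IsTemperedCurve φ) (h' : IsSmoothCurve ψ) :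
    IsSmoothCurve (fun t n y => φ t n y * ψ t n y) :=
  isSmoothCurve_iff.2 ⟨fun n => (h.1 n).mul (h'.1 n), fun t n => (h.2.1 t n).mul (h'.2.1 t n),
    fun T => .mul h.1 h'.1 (h.2.2 T) ((isSmoothCurve_iff.1 h').2.2 T)⟩

theorem IsSmoothCurve.add (h : IsSmoothCurve φ) (h' : IsSmoothCurve ψ) :
    IsSmoothCurve (fun t => φ t + ψ t) :=
  isSmoothCurve_iff.2 ⟨fun n => (h.1 n).add (h'.1 n), fun t n => (h.2.1 t n).add (h'.2.1 t n),
    fun T => .add h.1 h'.1 ((isSmoothCurve_iff.1 h).2.2 T) ((isSmoothCurve_iff.1 h').2.2 T)⟩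

theorem IsSmoothCurve.shift (h : IsSmoothCurve φ) (j : ℤ) :
    IsSmoothCurve (fun t n => φ t (n + j)) :=
  isSmoothCurve_iff.2 ⟨fun n => h.1 (n + j), fun t n => h.2.1 t (n + j),
    fun T => ((isSmoothCurve_iff.1 h).2.2 T).shift j⟩

theorem IsTempered.isTemperedCurve {a : LatticeFun} (ha : IsTempered a) :
    IsTemperedCurve (fun _ => a) :=
  ⟨fun n => (ha.1 n).1.comp contDiff_snd, fun _ n => (ha.1 n).2, fun _ =>
    PolyBound.comp (S := Set.univ) (ContinuousLinearMap.snd ℝ ℝ ℝ)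
      (ContinuousLinearMap.norm_snd_le ℝ ℝ ℝ) (fun _ _ => trivial) (fun n => (ha.1 n).1)
      (isTempered_iff.1 ha).2⟩

theorem IsSchwartz.isSmoothCurve {a : LatticeFun} (ha : IsSchwartz a) :
    IsSmoothCurve (fun _ => a) :=
  isSmoothCurve_iff.2 ⟨fun n => (ha.1 n).1.comp contDiff_snd, fun _ n => (ha.1 n).2, fun _ =>
    RapidBound.comp (S := Set.univ) (ContinuousLinearMap.snd ℝ ℝ ℝ)
      (ContinuousLinearMap.norm_snd_le ℝ ℝ ℝ) (fun _ _ => trivial) (fun n => (ha.1 n).1)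
      (isSchwartz_iff.1 ha).2⟩

theorem isSmoothCurve_zero : IsSmoothCurve (fun _ => 0) := isSchwartz_zero.isSmoothCurve

theorem IsSmoothCurve.sum {ι : Type*} {s : Finset ι} {φ : ι → ℝ → LatticeFun}
    (h : ∀ i ∈ s, IsSmoothCurve (φ i)) : IsSmoothCurve (fun t => ∑ i ∈ s, φ i t) := by
  have := Finset.sum_induction φ IsSmoothCurve (fun _ _ => .add) isSmoothCurve_zero h
  convert this using 2
  simp

theorem isTemperedCurve_time : IsTemperedCurve (fun t _ _ => (t : ℂ)) := by
  have hs : ContDiff ℝ ∞ (fun t : ℝ => (t : ℂ)) := Complex.ofRealCLM.contDiff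
  have hb : ∀ T : ℝ, PolyBound {t : ℝ | |t| ≤ T} (fun _ t => (t : ℂ)) := fun T p => by
    have hc : Continuous fun t : ℝ => ‖iteratedFDeriv ℝ p (fun t : ℝ => (t : ℂ)) t‖ :=
      (hs.continuous_iteratedFDeriv (by exact_mod_cast le_top)).norm
    -- There is no dependence on n, so continuity on the compact interval [-T, T] bounds every
    -- derivative.
    obtain ⟨C, hC⟩ := (isCompact_Icc (a := -T) (b := T)).bddAbove_image hc.continuousOn
    refine ⟨0, max C 0, le_max_right _ _, fun n t ht => ?_⟩
    rw [pow_zero, mul_one]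
    exact (hC ⟨t, abs_le.1 ht, rfl⟩).trans (le_max_left _ _)
  exact ⟨fun _ => hs.comp contDiff_fst, fun _ _ _ => rfl, fun T =>
    (hb T).comp (ContinuousLinearMap.fst ℝ ℝ ℝ) (ContinuousLinearMap.norm_fst_le ℝ ℝ ℝ)
      (fun _ hq => hq) fun _ => hs⟩

/-- The line through a Schwartz function is a smooth curve. -/
theorem IsSchwartz.isSmoothCurve_smul {a : LatticeFun} (ha : IsSchwartz a) :
    IsSmoothCurve (fun t => t • a) := by
  have := isTemperedCurve_time.mul_isSmoothCurve ha.isSmoothCurve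
  simpa [Pi.smul_def] using this

theorem IsSmoothCurve.differentiable (h : IsSmoothCurve φ) (n : ℤ) (y : ℝ) :
    Differentiable ℝ (fun t => φ t n y) :=
  ((h.1 n).comp (contDiff_prodMk_left y)).differentiable (by simp)

theorem IsSmoothCurve.hasDerivAt (h : IsSmoothCurve φ) (t : ℝ) (n : ℤ) (y : ℝ) :
    HasDerivAt (fun t => φ t n y) (vel φ t n y) t :=
  (h.differentiable n y t).hasDerivAt

theorem IsSmoothCurve.vel_isSchwartz (h : IsSmoothCurve φ) : IsSchwartz (vel φ 0) := by
  obtain ⟨Φ, hΦ⟩ : ∃ Φ : ℤ → ℝ × ℝ → ℂ, Φ = fun n q => φ q.1 n q.2 := ⟨_, rfl⟩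
  have hsm : ∀ n, ContDiff ℝ ∞ (Φ n) := fun n => by rw [hΦ]; exact h.1 n
  -- The slice t = 0 suffices: the derivatives bounded on it are the full ones in (t, y), so the
  -- direction (1, 0) is included.
  have hr : RapidBound {q : ℝ × ℝ | |q.1| ≤ 0} Φ := by
    rw [hΦ]; exact (isSmoothCurve_iff.1 h).2.2 0
  have e : vel φ 0 = fun n y =>
      fderiv ℝ (Φ n) (ContinuousLinearMap.inr ℝ ℝ ℝ y) (1, 0) := by
    funext n y
    have h1 : HasFDerivAt (Φ n) (fderiv ℝ (Φ n) (0, y)) (0, y) :=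
      ((hsm n).differentiable (by simp) _).hasFDerivAt
    have h2 : HasDerivAt (fun t : ℝ => (t, y)) ((1 : ℝ), (0 : ℝ)) 0 :=
      (hasDerivAt_id 0).prodMk (hasDerivAt_const 0 y)
    have h3 := (h1.comp_hasDerivAt 0 h2).deriv
    rw [ContinuousLinearMap.inr_apply, ← h3, hΦ]
    rfl
  have hs : ∀ n, ContDiff ℝ ∞ fun q => fderiv ℝ (Φ n) q (1, 0) :=
    fun n => ((hsm n).fderiv_right (m := ∞) (by simp)).clm_apply contDiff_const
  refine isSchwartz_iff.2 ⟨fun n => ⟨?_, fun y => ?_⟩, ?_⟩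
  · rw [e]
    exact (hs n).comp (ContinuousLinearMap.inr ℝ ℝ ℝ).contDiff
  · simp only [vel, h.2.1 _ n y]
  · rw [e]
    have hL : ‖ContinuousLinearMap.inr ℝ ℝ ℝ‖ ≤ 1 :=
      ContinuousLinearMap.opNorm_le_bound _ zero_le_one fun y => by simp
    have hv : ‖((1 : ℝ), (0 : ℝ))‖ ≤ 1 := by simp
    have hd := hr.fderiv_apply hsm (1, 0) hv
    exact RapidBound.comp (φ := fun n q => fderiv ℝ (Φ n) q (1, 0)) (T := Set.univ)
      (ContinuousLinearMap.inr ℝ ℝ ℝ) hL (by simp) hs hd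

end Curves

/-! ### Algebra of formal operators -/

section Algebra

/-- The coefficients of an operator vanish in large orders. -/
def IsOrderBounded (A : ShiftOp) : Prop := ∃ r : ℤ, ∀ j, r < j → A j = 0

variable {A A' B B' D P l : ShiftOp}

theorem isOrderBounded_zero : IsOrderBounded 0 := ⟨0, fun _ _ => rfl⟩

theorem IsOrderBounded.add (hA : IsOrderBounded A) (hB : IsOrderBounded B) :
    IsOrderBounded (A + B) := by
  obtain ⟨a, ha⟩ := hA
  obtain ⟨b, hb⟩ := hB
  refine ⟨max a b, fun j hj => ?_⟩
  rw [Pi.add_apply, ha j (by omega), hb j (by omega), add_zero]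

theorem IsOrderBounded.plusPart (hA : IsOrderBounded A) : IsOrderBounded (plusPart A) := by
  obtain ⟨a, ha⟩ := hA
  refine ⟨a, fun j hj => ?_⟩
  funext n y
  simp [ShiftLax.plusPart, ha j hj]

theorem plusPart_of_neg {j : ℤ} (hj : j < 0) : plusPart A j = 0 := by
  funext n y
  simp [plusPart, not_le.2 hj]

theorem plusPart_of_nonneg {j : ℤ} (hj : 0 ≤ j) : plusPart A j = A j := by
  funext n y
  simp [plusPart, hj]

theorem strictPart_of_pos {j : ℤ} (hj : 0 < j) : strictPart A j = A j := by
  funext n y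
  simp [strictPart, plusPart, zeroPart, hj.le, hj.ne']

theorem strictPart_of_nonpos {j : ℤ} (hj : j ≤ 0) : strictPart A j = 0 := by
  funext n y
  rcases hj.lt_or_eq with h | rfl
  · simp [strictPart, plusPart, zeroPart, not_le.2 h, h.ne]
  · simp [strictPart, plusPart, zeroPart]

/-- Only k - b ≤ i ≤ a contribute. This is needed for additivity, because `∑ᶠ` is zero by default
when the support is infinite. -/
theorem comp_support_finite (hA : IsOrderBounded A) (hB : IsOrderBounded B) (k n : ℤ) (y : ℝ) :
    (Function.support fun i : ℤ => A i n y * B (k - i) (n + i) y).Finite := by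
  obtain ⟨a, ha⟩ := hA
  obtain ⟨b, hb⟩ := hB
  refine (Set.finite_Icc (k - b) a).subset fun i hi => ?_
  by_contra h
  refine hi ?_
  rw [Set.mem_Icc, not_and_or, not_le, not_le] at h
  rcases h with h | h
  · simp [hb (k - i) (by omega)]
  · simp [ha i h]

theorem comp_apply (A B : ShiftOp) (k n : ℤ) (y : ℝ) :
    comp A B k n y = ∑ᶠ i : ℤ, A i n y * B (k - i) (n + i) y := rfl

theorem comm_apply (A B : ShiftOp) (k n : ℤ) (y : ℝ) :
    comm A B k n y = (∑ᶠ i : ℤ, A i n y * B (k - i) (n + i) y) -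
      ∑ᶠ i : ℤ, B i n y * A (k - i) (n + i) y := rfl

theorem centralComm_apply (c : ℂ) (A B : ShiftOp) (k n : ℤ) (y : ℝ) :
    centralComm c A B k n y = comm A B k n y - c * deriv (B k n) y := rfl

theorem comp_add_left (hA : IsOrderBounded A) (hA' : IsOrderBounded A') (hB : IsOrderBounded B) :
    comp (A + A') B = comp A B + comp A' B := by
  funext k n y
  simp only [Pi.add_apply, comp_apply]
  rw [← finsum_add_distrib (comp_support_finite hA hB k n y) (comp_support_finite hA' hB k n y)]
  exact finsum_congr fun i => by rw [add_mul]

theorem comp_add_right (hA : IsOrderBounded A) (hB : IsOrderBounded B) (hB' : IsOrderBounded B') :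
    comp A (B + B') = comp A B + comp A B' := by
  funext k n y
  simp only [Pi.add_apply, comp_apply]
  rw [← finsum_add_distrib (comp_support_finite hA hB k n y) (comp_support_finite hA hB' k n y)]
  exact finsum_congr fun i => by rw [mul_add]

theorem comp_zero_left : comp 0 B = 0 := by
  funext k n y
  simp [comp]

theorem comp_zero_right : comp A 0 = 0 := by
  funext k n y
  simp [comp]

theorem comm_add_left (hA : IsOrderBounded A) (hA' : IsOrderBounded A') (hB : IsOrderBounded B) :
    comm (A + A') B = comm A B + comm A' B := by
  simp only [comm, comp_add_left hA hA' hB, comp_add_right hB hA hA']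
  abel

theorem comm_zero_left : comm 0 B = 0 := by
  simp [comm, comp_zero_left, comp_zero_right]

theorem IsOrderBounded.sum {ι : Type*} (s : Finset ι) {X : ι → ShiftOp}
    (hX : ∀ i, IsOrderBounded (X i)) : IsOrderBounded (∑ i ∈ s, X i) :=
  Finset.sum_induction X IsOrderBounded (fun _ _ => .add) isOrderBounded_zero fun i _ => hX i

theorem comm_sum_left {ι : Type*} (s : Finset ι) {X : ι → ShiftOp}
    (hX : ∀ i, IsOrderBounded (X i)) (hB : IsOrderBounded B) :
    comm (∑ i ∈ s, X i) B = ∑ i ∈ s, comm (X i) B := by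
  classical
  induction s using Finset.induction_on with
  | empty => simp [comm_zero_left]
  | insert i s hi ih =>
    rw [Finset.sum_insert hi, Finset.sum_insert hi, comm_add_left (hX i) (.sum s hX) hB, ih]

theorem centralComm_add_left (c : ℂ) (hA : IsOrderBounded A) (hA' : IsOrderBounded A')
    (hB : IsOrderBounded B) : centralComm c (A + A') B = centralComm c A B + comm A' B := by
  rw [centralComm, comm_add_left hA hA' hB, centralComm]
  abel

theorem dress_of_pos (f g : LatticeFun) {j : ℤ} (hj : 0 < j) : dress f g j = 0 := by
  funext n y
  simp [dress, not_le.2 hj]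

theorem isOrderBounded_dress (f g : LatticeFun) : IsOrderBounded (dress f g) :=
  ⟨0, fun _ => dress_of_pos f g⟩

theorem dressSum_apply {N : ℕ} (f g : Fin N → LatticeFun) (j : ℤ) :
    dressSum f g j = ∑ i, dress (f i) (g i) j := by
  simp [dressSum, Finset.sum_apply]

theorem dressSum_of_pos {N : ℕ} (f g : Fin N → LatticeFun) {j : ℤ} (hj : 0 < j) :
    dressSum f g j = 0 := by
  rw [dressSum_apply]
  exact Finset.sum_eq_zero fun i _ => dress_of_pos _ _ hj

/-- The part of nonpositive order of `f ℰ(ℰ - 1)⁻¹ g P`, for a difference operator `P`. -/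
theorem dress_comp_of_nonpos (hP : ∀ j < 0, P j = 0) (f g : LatticeFun) {k : ℤ} (hk : k ≤ 0) :
    comp (dress f g) P k = dress f (act (adj P) g) k := by
  funext n y
  simp only [comp, dress, if_pos hk, act, adj]
  -- Over a field a scalar passes through `∑ᶠ` whether or not the support is finite, so no order
  -- bound on `P` is required.
  rw [← smul_eq_mul, smul_finsum, ← finsum_comp_equiv (Equiv.addRight k)]
  refine finsum_congr fun i => ?_
  change (if i + k ≤ 0 then f n y * g (n + (i + k)) y else 0) * P (k - (i + k)) (n + (i + k)) y
    = f n y * (P (-i) (n + k + i) y * g (n + k + i) y)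
  rw [show k - (i + k) = -i by ring,
    show n + (i + k) = n + k + i by ring]
  by_cases hi : i + k ≤ 0
  · rw [if_pos hi]
    ring
  -- Here k ≤ 0 enters: i + k > 0 forces -i < 0, so the cutoff in the dressing loses nothing.
  · rw [hP (-i) (by omega)]
    simp

/-- The part of nonpositive order of `P f ℰ(ℰ - 1)⁻¹ g`, for a difference operator `P`. -/
theorem comp_dress_of_nonpos (hP : ∀ j < 0, P j = 0) (f g : LatticeFun) {k : ℤ} (hk : k ≤ 0) :
    comp P (dress f g) k = dress (act P f) g k := by
  funext n y
  simp only [comp, dress, if_pos hk, act]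
  rw [mul_comm, ← smul_eq_mul, smul_finsum]
  refine finsum_congr fun i => ?_
  rw [smul_eq_mul, show n + i + (k - i) = n + k by ring]
  rcases lt_or_ge i 0 with hi | hi
  · rw [hP i hi]
    simp
  · rw [if_pos (by omega)]
    ring

theorem comm_dress_of_nonpos (hP : ∀ j < 0, P j = 0) (f g : LatticeFun) {k : ℤ} (hk : k ≤ 0) :
    comm (dress f g) P k = dress f (act (adj P) g) k - dress (act P f) g k := by
  rw [comm, Pi.sub_apply, dress_comp_of_nonpos hP f g hk, comp_dress_of_nonpos hP f g hk]

/-- Dressings have no positive orders, so the commutator splits into its strict part and a sum of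
dressings; the latter is what B' later supplies. -/
theorem comm_dressSum {N : ℕ} (hP : ∀ j < 0, P j = 0) (hb : IsOrderBounded P)
    (f g : Fin N → LatticeFun) :
    comm (dressSum f g) P = strictPart (comm (dressSum f g) P) +
      ∑ i, (dress (f i) (act (adj P) (g i)) - dress (act P (f i)) (g i)) := by
  funext k
  rw [Pi.add_apply, Finset.sum_apply]
  rcases lt_or_ge 0 k with hk | hk
  · rw [strictPart_of_pos hk, left_eq_add]
    refine Finset.sum_eq_zero fun i _ => ?_
    rw [Pi.sub_apply, dress_of_pos _ _ hk, dress_of_pos _ _ hk, sub_zero]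
  · rw [strictPart_of_nonpos hk, zero_add, dressSum,
      comm_sum_left _ (fun i => isOrderBounded_dress _ _) hb, Finset.sum_apply]
    exact Finset.sum_congr rfl fun i _ => comm_dress_of_nonpos hP _ _ hk

/-- Commutators with operators of nonpositive order: the part of positive order. -/
theorem strictPart_comm_plusPart (hD : ∀ j, 0 < j → D j = 0) (A : ShiftOp) :
    strictPart (comm D A) = strictPart (comm D (plusPart A)) := by
  funext k
  rcases lt_or_ge 0 k with hk | hk
  -- A factor of order at most 0 from `D` must meet a coefficient of `A` of order at least k > 0.
  · rw [strictPart_of_pos hk, strictPart_of_pos hk]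
    funext n y
    rw [comm_apply, comm_apply]
    congr 1
    · refine finsum_congr fun i => ?_
      rcases lt_or_ge 0 i with hi | hi
      · simp [hD i hi]
      · rw [plusPart_of_nonneg (by omega : 0 ≤ k - i)]
    · refine finsum_congr fun i => ?_
      rcases lt_or_ge i 0 with hi | hi
      · simp [hD (k - i) (by omega)]
      · rw [plusPart_of_nonneg hi]
  · rw [strictPart_of_nonpos hk, strictPart_of_nonpos hk]

theorem plusPart_congr {m : ℕ} (hm : 1 ≤ m) (h : ∀ j : ℤ, -(m : ℤ) < j → A j = A' j) :
    plusPart A = plusPart A' := by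
  funext j
  rcases lt_or_ge j 0 with hj | hj
  · rw [plusPart_of_neg hj, plusPart_of_neg hj]
  · rw [plusPart_of_nonneg hj, plusPart_of_nonneg hj, h j (by omega)]

/-- At an operator of order `m`, the terms of order `≤ -m` do not contribute to `θ̃`. -/
theorem thetaOp_congr (c : ℂ) {m : ℕ} (hm : 1 ≤ m) (hl : ∀ j : ℤ, (m : ℤ) < j → l j = 0)
    (h : ∀ j : ℤ, -(m : ℤ) < j → A j = A' j) : thetaOp c l A = thetaOp c l A' := by
  rw [thetaOp, thetaOp, plusPart_congr hm h]
  congr 1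
  funext k
  rcases lt_or_ge 0 k with hk | hk
  -- Since `l` has order at most m, a product of order k > 0 uses only coefficients of `A` of order
  -- at least k - m > -m.
  · rw [strictPart_of_pos hk, strictPart_of_pos hk]
    funext n y
    rw [centralComm_apply, centralComm_apply, comm_apply, comm_apply, h k (by omega)]
    congr 2
    · refine finsum_congr fun i => ?_
      rcases lt_or_ge (m : ℤ) i with hi | hi
      · simp [hl i hi]
      · rw [h (k - i) (by omega)]
    · refine finsum_congr fun i => ?_
      rcases lt_or_ge (-(m : ℤ)) i with hi | hi
      · rw [h i hi]
      · simp [hl (k - i) (by omega)]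
  · rw [strictPart_of_nonpos hk, strictPart_of_nonpos hk]

theorem dress_neg_left (f g : LatticeFun) : dress (-f) g = -dress f g := by
  funext j n y
  by_cases h : j ≤ 0 <;> simp [dress, h]

/-- If `A` is invariant at `l̃ + ∑ᵢ fᵢ ℰ(ℰ - 1)⁻¹ gᵢ`, then the transformed Poisson structure
maps it to the commutator with `A₊`. -/
theorem thetaOp_add_dress_eq_centralComm (c : ℂ) {N : ℕ} (f g : Fin N → LatticeFun)
    (hl : IsOrderBounded l) (hA : IsOrderBounded A)
    (h : centralComm c (l + dressSum f g) A = 0) :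
    thetaOp c l A + ∑ i, (dress (-act (plusPart A) (f i)) (g i)
      + dress (f i) (act (adj (plusPart A)) (g i)))
      = centralComm c (l + dressSum f g) (plusPart A) := by
  have hD : IsOrderBounded (dressSum f g) := ⟨0, fun _ => dressSum_of_pos f g⟩
  rw [centralComm_add_left c hl hD hA] at h
  -- The Casimir relation trades [l̃ - c∂/∂y, A] for -[D, A], whose positive part sees only A₊.
  have hs : strictPart (centralComm c l A) = -strictPart (comm (dressSum f g) (plusPart A)) := by
    rw [← strictPart_comm_plusPart (fun _ => dressSum_of_pos f g), eq_neg_of_add_eq_zero_left h]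
    funext k
    rw [Pi.neg_apply]
    rcases lt_or_ge 0 k with hk | hk
    · rw [strictPart_of_pos hk, strictPart_of_pos hk, Pi.neg_apply]
    · rw [strictPart_of_nonpos hk, strictPart_of_nonpos hk, neg_zero]
  rw [centralComm_add_left c hl hD hA.plusPart,
    comm_dressSum (fun _ => plusPart_of_neg) hA.plusPart, thetaOp, hs]
  simp only [dress_neg_left, sub_eq_add_neg, neg_neg, add_comm (-dress _ _)]
  abel

/-- The two terms c ∂A/∂y cancel in positive orders and are both cut off in negative ones, so only
order zero survives. -/
theorem neg_thetaOp (c : ℂ) (l A : ShiftOp) :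
    -thetaOp c l A = comm (plusPart A) l - strictPart (comm A l) + c • dy (zeroPart A) := by
  funext k n y
  have hp : dy (plusPart A) k n y = if 0 ≤ k then dy A k n y else 0 := by
    split_ifs with hk
    · simp only [dy, plusPart_of_nonneg hk]
    · simp only [dy, plusPart_of_neg (not_le.1 hk)]
      exact deriv_const _ _
  have hz : dy (zeroPart A) k n y = if k = 0 then dy A k n y else 0 := by
    split_ifs with hk
    · have e : zeroPart A k n = A k n := by funext y; simp [zeroPart, hk]
      simp only [dy, e]
    · have e : zeroPart A k n = fun _ => 0 := by funext y; simp [zeroPart, hk]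
      simp only [dy, e, deriv_const]
  have hc : dy A k n y = deriv (A k n) y := rfl
  have hc' : dy (plusPart A) k n y = deriv (plusPart A k n) y := rfl
  have ha (X Y : ShiftOp) : comm Y X k n y = -comm X Y k n y := (neg_sub _ _).symm
  simp only [thetaOp, Pi.neg_apply, Pi.sub_apply, Pi.add_apply, Pi.smul_apply, smul_eq_mul, hz,
    centralComm_apply, ← hc', hp, ha l]
  rcases lt_trichotomy k 0 with hk | hk | hk
  · rw [strictPart_of_nonpos hk.le, strictPart_of_nonpos hk.le]
    simp [hk.ne, not_le.2 hk]
  · rw [strictPart_of_nonpos hk.le, strictPart_of_nonpos hk.le]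
    simp [hk]
    ring
  · rw [strictPart_of_pos hk, strictPart_of_pos hk, centralComm_apply, ← hc, ha l]
    simp only [hk.ne', hk.le, if_true, if_false]
    ring

end Algebra

/-! ### Summation and integration of rapidly decreasing functions -/

section Pairings

theorem summable_inv_weight_sq : Summable fun n : ℤ => ((1 + |(n : ℝ)|) ^ 2)⁻¹ := by
  have h1 : Summable fun n : ℤ => 1 / (n : ℝ) ^ 2 := Real.summable_one_div_int_pow.2 one_lt_two
  -- At n = 0 the comparison term 1/n² is zero by convention, so that site is majorized separately.
  have h2 : Summable fun n : ℤ => if n = 0 then (1 : ℝ) else 0 :=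
    (hasSum_ite_eq 0 1).summable
  refine Summable.of_nonneg_of_le (fun n => by positivity) (fun n => ?_) (h1.add h2)
  rcases eq_or_ne n 0 with rfl | hn
  · simp
  · have : (0 : ℝ) < |(n : ℝ)| := abs_pos.2 (by exact_mod_cast hn)
    rw [if_neg hn, add_zero, ← sq_abs (n : ℝ), one_div]
    gcongr
    linarith

variable {u v w : LatticeFun}

/-- A majorant uniform in y gives both summability and, by the Weierstrass test, continuity of the
sum over n. -/
theorem IsSchwartz.exists_summable_bound (hu : IsSchwartz u) :
    ∃ b : ℤ → ℝ, Summable b ∧ ∀ n y, ‖u n y‖ ≤ b n := by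
  obtain ⟨C, h⟩ := hu.2 2 0
  refine ⟨fun n => C * ((1 + |(n : ℝ)|) ^ 2)⁻¹, summable_inv_weight_sq.mul_left C, fun n y => ?_⟩
  have := h n y
  rw [iteratedDeriv_zero] at this
  change ‖u n y‖ ≤ C * ((1 + |(n : ℝ)|) ^ 2)⁻¹
  rw [← div_eq_mul_inv, le_div_iff₀ (by positivity), mul_comm]
  exact this

theorem IsSchwartz.summable (hu : IsSchwartz u) (y : ℝ) : Summable fun n => u n y := by
  obtain ⟨b, hb, h⟩ := hu.exists_summable_bound
  exact .of_norm_bounded hb fun n => h n y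

theorem IsSchwartz.continuous_tsum (hu : IsSchwartz u) : Continuous fun y => ∑' n, u n y := by
  obtain ⟨b, hb, h⟩ := hu.exists_summable_bound
  exact _root_.continuous_tsum (fun n => (hu.1 n).1.continuous) hb fun n y => h n y

theorem IsSchwartz.integral_tsum_add (hu : IsSchwartz u) (hv : IsSchwartz v) :
    (∫ y in (0 : ℝ)..(2 * Real.pi), ∑' n : ℤ, (u + v) n y)
      = (∫ y in (0 : ℝ)..(2 * Real.pi), ∑' n : ℤ, u n y)
        + ∫ y in (0 : ℝ)..(2 * Real.pi), ∑' n : ℤ, v n y := by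
  rw [← intervalIntegral.integral_add (hu.continuous_tsum.intervalIntegrable _ _)
    (hv.continuous_tsum.intervalIntegrable _ _)]
  refine intervalIntegral.integral_congr fun y _ => ?_
  exact (hu.summable y).tsum_add (hv.summable y)

/-! ### Coefficients of products -/

variable {m : ℕ} {A P h h' : ShiftOp} {f g α β : LatticeFun}

theorem IsOpTangent.isOrderBounded (hh : IsOpTangent m h) : IsOrderBounded h :=
  ⟨m, fun j hj => hh.1 j hj.le⟩

theorem IsOpTangent.add (hh : IsOpTangent m h) (hh' : IsOpTangent m h') :
    IsOpTangent m (h + h') :=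
  ⟨fun j hj => by rw [Pi.add_apply, hh.1 j hj, hh'.1 j hj, add_zero],
    fun j => (hh.2 j).add (hh'.2 j)⟩

theorem isOpTangent_zero (m : ℕ) : IsOpTangent m 0 := ⟨fun _ _ => rfl, fun _ => isSchwartz_zero⟩

theorem IsOpTangent.sum {ι : Type*} (s : Finset ι) {X : ι → ShiftOp}
    (hX : ∀ i, IsOpTangent m (X i)) : IsOpTangent m (∑ i ∈ s, X i) :=
  Finset.sum_induction X (IsOpTangent m) (fun _ _ => .add) (isOpTangent_zero m) fun i _ => hX i

theorem isOpTangent_dress (hm : 1 ≤ m) (h : ∀ j : ℤ, IsSchwartz fun n y => f n y * g (n + j) y) :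
    IsOpTangent m (dress f g) := by
  refine ⟨fun j hj => dress_of_pos _ _ (by omega), fun j => ?_⟩
  by_cases hj : j ≤ 0
  · have e : dress f g j = fun n y => f n y * g (n + j) y := by
      funext n y
      simp [dress, hj]
    rw [e]
    exact h j
  · rw [dress_of_pos _ _ (not_le.1 hj)]
    exact isSchwartz_zero

theorem isOpTangent_dress_left (hm : 1 ≤ m) (hα : IsSchwartz α) (hg : IsTempered g) :
    IsOpTangent m (dress α g) :=
  isOpTangent_dress hm fun j => by
    have := (hg.shift j).mul_isSchwartz hα
    simpa only [mul_comm] using this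

theorem isOpTangent_dress_right (hm : 1 ≤ m) (hf : IsTempered f) (hβ : IsSchwartz β) :
    IsOpTangent m (dress f β) :=
  isOpTangent_dress hm fun j => hf.mul_isSchwartz (hβ.shift j)

theorem IsOpCovector.isSchwartz_comp (hA : IsOpCovector A) (hh : IsOpTangent m h) (k : ℤ) :
    IsSchwartz (comp A h k) := by
  obtain ⟨r, hr⟩ := hA.1
  have e : comp A h k = ∑ i ∈ Finset.Icc (k - m) r, fun n y => A i n y * h (k - i) (n + i) y := by
    funext n y
    rw [Finset.sum_apply, Finset.sum_apply, comp_apply]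
    refine finsum_eq_sum_of_support_subset _ fun i hi => ?_
    by_contra hc
    refine hi ?_
    rw [Finset.coe_Icc, Set.mem_Icc, not_and_or, not_le, not_le] at hc
    rcases hc with hc | hc
    · simp [hh.1 (k - i) (by omega)]
    · simp [hr i hc]
  rw [e]
  exact .sum fun i _ => (hA.2 i).mul_isSchwartz ((hh.2 _).shift i)

/-- The index range is independent of n and y, so the sum can be exchanged with the sum over the
lattice. -/
theorem act_eq_sum {r : ℤ} (hr : ∀ j, r < j → P j = 0) (hP : ∀ j < 0, P j = 0)
    (f : LatticeFun) (n : ℤ) (y : ℝ) :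
    act P f n y = ∑ i ∈ Finset.Icc 0 r, P i n y * f (n + i) y := by
  refine finsum_eq_sum_of_support_subset _ fun i hi => ?_
  by_contra hc
  refine hi ?_
  rw [Finset.coe_Icc, Set.mem_Icc, not_and_or, not_le, not_le] at hc
  rcases hc with hc | hc
  · simp [hP i hc]
  · simp [hr i hc]

theorem act_adj_eq_sum {r : ℤ} (hr : ∀ j, r < j → P j = 0) (hP : ∀ j < 0, P j = 0)
    (f : LatticeFun) (n : ℤ) (y : ℝ) :
    act (adj P) f n y = ∑ i ∈ Finset.Icc 0 r, P i (n - i) y * f (n - i) y := by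
  have e : act (adj P) f n y = ∑ᶠ i : ℤ, P i (n - i) y * f (n - i) y := by
    rw [← finsum_comp_equiv (Equiv.neg ℤ)]
    refine finsum_congr fun i => ?_
    simp [adj]
  rw [e]
  refine finsum_eq_sum_of_support_subset _ fun i hi => ?_
  by_contra hc
  refine hi ?_
  rw [Finset.coe_Icc, Set.mem_Icc, not_and_or, not_le, not_le] at hc
  rcases hc with hc | hc
  · simp [hP i hc]
  · simp [hr i hc]

theorem IsOpCovector.plusPart (hA : IsOpCovector A) : IsOpCovector (plusPart A) := by
  refine ⟨IsOrderBounded.plusPart hA.1, fun j => ?_⟩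
  rcases lt_or_ge j 0 with hj | hj
  · rw [plusPart_of_neg hj]
    exact isTempered_zero
  · rw [plusPart_of_nonneg hj]
    exact hA.2 j

theorem IsOpCovector.isTempered_act (hA : IsOpCovector A) (hf : IsTempered f) :
    IsTempered (act (ShiftLax.plusPart A) f) := by
  obtain ⟨r, hr⟩ := hA.plusPart.1
  have e : act (ShiftLax.plusPart A) f
      = ∑ i ∈ Finset.Icc 0 r, fun n y => ShiftLax.plusPart A i n y * f (n + i) y := by
    funext n y
    rw [act_eq_sum hr (fun _ => plusPart_of_neg), Finset.sum_apply, Finset.sum_apply]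
  rw [e]
  exact .sum fun i _ => (hA.plusPart.2 i).mul (hf.shift i)

theorem IsOpCovector.isTempered_act_adj (hA : IsOpCovector A) (hf : IsTempered f) :
    IsTempered (act (adj (ShiftLax.plusPart A)) f) := by
  obtain ⟨r, hr⟩ := hA.plusPart.1
  have e : act (adj (ShiftLax.plusPart A)) f = ∑ i ∈ Finset.Icc 0 r,
      fun n y => ShiftLax.plusPart A i (n + -i) y * f (n + -i) y := by
    funext n y
    rw [act_adj_eq_sum hr (fun _ => plusPart_of_neg), Finset.sum_apply, Finset.sum_apply]
    rfl
  rw [e]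
  exact .sum fun i _ => ((hA.plusPart.2 i).shift (-i)).mul (hf.shift (-i))

/-! ### The pairings -/

theorem opPair_add_right (hA : IsOpCovector A) (hh : IsOpTangent m h) (hh' : IsOpTangent m h') :
    opPair A (h + h') = opPair A h + opPair A h' := by
  simp only [opPair]
  rw [← (hA.isSchwartz_comp hh 0).integral_tsum_add (hA.isSchwartz_comp hh' 0),
    comp_add_right hA.1 hh.isOrderBounded hh'.isOrderBounded]
  rfl

theorem opPair_zero_right (A : ShiftOp) : opPair A 0 = 0 := by
  simp [opPair, comp_zero_right]

theorem opPair_sum_right {ι : Type*} (s : Finset ι) (hA : IsOpCovector A) {X : ι → ShiftOp}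
    (hX : ∀ i, IsOpTangent m (X i)) : opPair A (∑ i ∈ s, X i) = ∑ i ∈ s, opPair A (X i) := by
  classical
  induction s using Finset.induction_on with
  | empty => simp [opPair_zero_right]
  | insert i s hi ih =>
    rw [Finset.sum_insert hi, Finset.sum_insert hi, opPair_add_right hA (hX i) (.sum s hX), ih]

theorem funPair_add_left (hu : IsTempered u) (hv : IsTempered v) (hw : IsSchwartz w) :
    funPair (u + v) w = funPair u w + funPair v w := by
  simp only [funPair]
  rw [← (hu.mul_isSchwartz hw).integral_tsum_add (hv.mul_isSchwartz hw)]
  refine intervalIntegral.integral_congr fun y _ => tsum_congr fun n => add_mul _ _ _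

theorem funPair_zero_left (u : LatticeFun) : funPair 0 u = 0 := by
  simp [funPair]

theorem funPair_zero_right (u : LatticeFun) : funPair u 0 = 0 := by
  simp [funPair]

/-- `(A, f ℰ(ℰ - 1)⁻¹ β) = ⟨A₊ f, β⟩`. -/
theorem opPair_dress_right (A : ShiftOp) (f β : LatticeFun) :
    opPair A (dress f β) = funPair (act (plusPart A) f) β := by
  refine intervalIntegral.integral_congr fun y _ => tsum_congr fun n => ?_
  rw [comp_apply, act, mul_comm, ← smul_eq_mul, smul_finsum]
  refine finsum_congr fun i => ?_
  rw [smul_eq_mul]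
  rcases lt_or_ge i 0 with hi | hi
  · rw [dress_of_pos _ _ (by omega), plusPart_of_neg hi]
    simp
  · rw [plusPart_of_nonneg hi, dress, if_pos (by omega), show n + i + (0 - i) = n by ring]
    ring

/-- `(A, α ℰ(ℰ - 1)⁻¹ g) = ⟨(A₊)* g, α⟩`. -/
theorem opPair_dress_left (hA : IsOpCovector A) (hα : IsSchwartz α) (hg : IsTempered g) :
    opPair A (dress α g) = funPair (act (adj (plusPart A)) g) α := by
  obtain ⟨r, hr⟩ := hA.plusPart.1
  have hP : ∀ j < 0, plusPart A j = 0 := fun _ => plusPart_of_neg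
  refine intervalIntegral.integral_congr fun y _ => ?_
  have e1 : ∀ n, comp A (dress α g) 0 n y
      = ∑ i ∈ Finset.Icc 0 r, plusPart A i n y * g n y * α (n + i) y := fun n => by
    have : comp A (dress α g) 0 n y = g n y * act (plusPart A) α n y := by
      rw [comp_apply, act, ← smul_eq_mul, smul_finsum]
      refine finsum_congr fun i => ?_
      rw [smul_eq_mul]
      rcases lt_or_ge i 0 with hi | hi
      · rw [dress_of_pos _ _ (by omega), plusPart_of_neg hi]
        simp
      · rw [plusPart_of_nonneg hi, dress, if_pos (by omega), show n + i + (0 - i) = n by ring]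
        ring
    rw [this, act_eq_sum hr hP, Finset.mul_sum]
    exact Finset.sum_congr rfl fun i _ => by ring
  have e2 : ∀ n, act (adj (plusPart A)) g n y * α n y
      = ∑ i ∈ Finset.Icc 0 r, plusPart A i (n - i) y * g (n - i) y * α n y := fun n => by
    rw [act_adj_eq_sum hr hP, Finset.sum_mul]
  have hs : ∀ i, Summable fun n => plusPart A i n y * g n y * α (n + i) y := fun i =>
    (((hA.plusPart.2 i).mul hg).mul_isSchwartz (hα.shift i)).summable y
  have hs' : ∀ i, Summable fun n => plusPart A i (n - i) y * g (n - i) y * α n y := fun i =>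
    ((((hA.plusPart.2 i).mul hg).shift (-i)).mul_isSchwartz hα).summable y
  simp only [e1, e2]
  -- Unlike `opPair_dress_right`, this is not an identity site by site: each i needs its own
  -- translation of n, hence the exchange of sums.
  rw [Summable.tsum_finsetSum fun i _ => hs i, Summable.tsum_finsetSum fun i _ => hs' i]
  refine Finset.sum_congr rfl fun i _ => ?_
  rw [← (Equiv.addRight i).tsum_eq fun n => plusPart A i (n - i) y * g (n - i) y * α n y]
  refine tsum_congr fun n => ?_
  simp

variable {N : ℕ}

/-- `B'*` is conjugate to `B'`. -/
theorem extPair_backlundDeriv (hm : 1 ≤ m) {x v w : Triple N}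
    (hx : ∀ i, IsTempered (x.2.1 i)) (hx' : ∀ i, IsTempered (x.2.2 i)) (hv : IsTangent m v)
    (hw : IsCovector w) : extPair w (backlundDeriv x v) = extPair (backlundConj x w) v := by
  have h1 i := isOpTangent_dress_left hm (hv.2.1 i) (hx' i)
  have h2 i := isOpTangent_dress_right hm (hx i) (hv.2.2 i)
  simp only [extPair, backlundDeriv, backlundConj]
  rw [opPair_add_right hw.1 hv.1 (.sum _ fun i => (h1 i).add (h2 i)),
    opPair_sum_right _ hw.1 fun i => (h1 i).add (h2 i), add_assoc, ← Finset.sum_add_distrib]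
  congr 1
  refine Finset.sum_congr rfl fun i _ => ?_
  rw [opPair_add_right hw.1 (h1 i) (h2 i), opPair_dress_left hw.1 (hv.2.1 i) (hx' i),
    opPair_dress_right, funPair_add_left (hw.2.1 i) (hw.1.isTempered_act_adj (hx' i)) (hv.2.1 i),
    funPair_add_left (hw.2.2 i) (hw.1.isTempered_act (hx i)) (hv.2.2 i)]
  ring

end Pairings

/-! ### Uniqueness of gradients -/

section Uniqueness

/-- The pairing is bilinear, so positivity comes from testing against the conjugate; periodicity
brings any point into the interval of integration. -/
theorem eq_zero_of_integral_mul_conj {D : ℝ → ℂ} (hc : Continuous D)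
    (hp : Function.Periodic D (2 * Real.pi))
    (h : ∫ y in (0 : ℝ)..(2 * Real.pi), D y * starRingEnd ℂ (D y) = 0) : D = 0 := by
  simp only [Complex.mul_conj] at h
  rw [intervalIntegral.integral_ofReal, Complex.ofReal_eq_zero] at h
  funext y
  by_contra hy
  obtain ⟨y', hy', e⟩ := hp.exists_mem_Ico₀ Real.two_pi_pos y
  refine (intervalIntegral.integral_pos (f := fun y => Complex.normSq (D y)) Real.two_pi_pos
    (Complex.continuous_normSq.comp hc).continuousOn
    (fun _ _ => Complex.normSq_nonneg _) ⟨y', ⟨hy'.1, hy'.2.le⟩, ?_⟩).ne' h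
  rw [← e]
  exact Complex.normSq_pos.2 hy

/-- The test function is the conjugate of χ - χ' at one site n₀ and zero elsewhere, which is
Schwartz whatever the growth in n. -/
theorem IsTempered.eq_of_funPair_eq {χ χ' : LatticeFun} (hχ : IsTempered χ)
    (hχ' : IsTempered χ') (h : ∀ u, IsSchwartz u → funPair χ u = funPair χ' u) : χ = χ' := by
  funext n₀
  have hD : IsTempered (χ - χ') := hχ.sub hχ'
  rw [← sub_eq_zero]
  refine eq_zero_of_integral_mul_conj (D := (χ - χ') n₀) (hD.1 n₀).1.continuous (hD.1 n₀).2 ?_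
  have hpair : ∀ u : LatticeFun, funPair u
      (fun n y => if n = n₀ then starRingEnd ℂ ((χ - χ') n₀ y) else 0)
      = ∫ y in (0 : ℝ)..(2 * Real.pi), u n₀ y * starRingEnd ℂ ((χ - χ') n₀ y) := fun u => by
    refine intervalIntegral.integral_congr fun y _ => ?_
    change (∑' n : ℤ, u n y * if n = n₀ then starRingEnd ℂ ((χ - χ') n₀ y) else 0) = _
    rw [tsum_eq_single n₀ fun n hn => by rw [if_neg hn, mul_zero], if_pos rfl]
  have hi : ∀ u : LatticeFun, IsTempered u → IntervalIntegrable
      (fun y => u n₀ y * starRingEnd ℂ ((χ - χ') n₀ y)) MeasureTheory.volume 0 (2 * Real.pi) :=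
    fun u hu => ((hu.1 n₀).1.continuous.mul
      (Complex.continuous_conj.comp (hD.1 n₀).1.continuous)).intervalIntegrable _ _
  have := h _ (hD.isSchwartz_conj_single n₀ n₀)
  rw [hpair, hpair, ← sub_eq_zero, ← intervalIntegral.integral_sub (hi χ hχ) (hi χ' hχ')] at this
  rw [← this]
  exact intervalIntegral.integral_congr fun y _ => sub_mul _ _ _

/-- Variations of a single coefficient. -/
theorem opPair_single (A : ShiftOp) (j : ℤ) (u : LatticeFun) :
    opPair A (Pi.single (-j) fun n => u (n + -j)) = funPair (A j) u := by
  refine intervalIntegral.integral_congr fun y _ => tsum_congr fun n => ?_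
  rw [comp_apply, finsum_eq_single _ j fun i hi => ?_]
  · rw [show (0 : ℤ) - j = -j by ring, Pi.single_eq_same, show n + j + -j = n by ring]
  · rw [Pi.single_eq_of_ne (by omega)]
    simp

theorem isOpTangent_single {m : ℕ} {j : ℤ} (hj : j < m) {u : LatticeFun} (hu : IsSchwartz u) :
    IsOpTangent m (Pi.single j u) := by
  refine ⟨fun k hk => Pi.single_eq_of_ne (by omega) _, fun k => ?_⟩
  rcases eq_or_ne k j with rfl | hk
  · rwa [Pi.single_eq_same]
  · rw [Pi.single_eq_of_ne hk]
    exact isSchwartz_zero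

/-- The coefficient of order j is detected by a variation of order -j, which is allowed exactly when
-j < m. -/
theorem IsOpCovector.coeff_eq_of_opPair_eq {m : ℕ} {A A' : ShiftOp} (hA : IsOpCovector A)
    (hA' : IsOpCovector A') (h : ∀ v, IsOpTangent m v → opPair A v = opPair A' v) {j : ℤ}
    (hj : -(m : ℤ) < j) : A j = A' j := by
  refine (hA.2 j).eq_of_funPair_eq (hA'.2 j) fun u hu => ?_
  rw [← opPair_single, ← opPair_single]
  exact h _ (isOpTangent_single (by omega) (hu.shift _))

variable {m N : ℕ} {F : Triple N → ℂ} {x v w w' : Triple N}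

theorem IsTangent.isCurve_smul (hv : IsTangent m v) : IsCurve m (fun t : ℝ => t • v) :=
  ⟨⟨fun t j hj => by
      change t • v.1 j = 0
      rw [hv.1.1 j hj, smul_zero], fun j => (hv.1.2 j).isSmoothCurve_smul⟩,
    fun i => (hv.2.1 i).isSmoothCurve_smul, fun i => (hv.2.2 i).isSmoothCurve_smul⟩

theorem vel_smul (a : LatticeFun) (t : ℝ) : vel (fun s : ℝ => s • a) t = a := by
  funext n y
  have h : HasDerivAt (fun s : ℝ => s • a n y) ((1 : ℝ) • a n y) t :=
    (hasDerivAt_id t).smul_const _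
  rw [one_smul] at h
  exact h.deriv

theorem extVel_smul (v : Triple N) (t : ℝ) : extVel (fun s : ℝ => s • v) t = v :=
  Prod.ext (funext fun j => vel_smul (v.1 j) t)
    (Prod.ext (funext fun i => vel_smul (v.2.1 i) t) (funext fun i => vel_smul (v.2.2 i) t))

/-- Every tangent vector is the velocity of a straight line, which is an admissible curve;
derivatives along it are unique. -/
theorem IsGradientAt.extPair_eq (h : IsGradientAt m F x w) (h' : IsGradientAt m F x w')
    (hv : IsTangent m v) : extPair w v = extPair w' v := by
  have h1 := h.2 _ hv.isCurve_smul (zero_smul ℝ v)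
  have h2 := h'.2 _ hv.isCurve_smul (zero_smul ℝ v)
  rw [extVel_smul] at h1 h2
  exact h1.unique h2

theorem IsGradientAt.coeff_eq (h : IsGradientAt m F x w) (h' : IsGradientAt m F x w')
    (j : ℤ) (hj : -(m : ℤ) < j) : w.1 j = w'.1 j := by
  refine h.1.1.coeff_eq_of_opPair_eq h'.1.1 (fun v hv => ?_) hj
  have hv' : IsTangent m ((v, 0, 0) : Triple N) :=
    ⟨hv, fun _ => isSchwartz_zero, fun _ => isSchwartz_zero⟩
  simpa [extPair, funPair_zero_right] using h.extPair_eq h' hv'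

theorem isSchwartz_single {u : LatticeFun} (hu : IsSchwartz u) (i k : Fin N) :
    IsSchwartz ((Pi.single i u : Fin N → LatticeFun) k) := by
  rcases eq_or_ne k i with rfl | hk
  · rwa [Pi.single_eq_same]
  · rw [Pi.single_eq_of_ne hk]
    exact isSchwartz_zero

theorem sum_funPair_single (χ : Fin N → LatticeFun) (i : Fin N) (u : LatticeFun) :
    ∑ k, funPair (χ k) ((Pi.single i u : Fin N → LatticeFun) k) = funPair (χ i) u := by
  rw [Finset.sum_eq_single i (fun k _ hk => by rw [Pi.single_eq_of_ne hk, funPair_zero_right])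
    (fun hi => absurd (Finset.mem_univ i) hi), Pi.single_eq_same]

theorem IsGradientAt.snd_eq (h : IsGradientAt m F x w) (h' : IsGradientAt m F x w') :
    w.2 = w'.2 := by
  refine Prod.ext (funext fun i => ?_) (funext fun i => ?_)
  · refine (h.1.2.1 i).eq_of_funPair_eq (h'.1.2.1 i) fun u hu => ?_
    have hv : IsTangent m ((0, Pi.single i u, 0) : Triple N) :=
      ⟨isOpTangent_zero m, isSchwartz_single hu i, fun _ => isSchwartz_zero⟩
    simpa [extPair, funPair_zero_right, opPair_zero_right, sum_funPair_single]
      using h.extPair_eq h' hv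
  · refine (h.1.2.2 i).eq_of_funPair_eq (h'.1.2.2 i) fun u hu => ?_
    have hv : IsTangent m ((0, 0, Pi.single i u) : Triple N) :=
      ⟨isOpTangent_zero m, fun _ => isSchwartz_zero, isSchwartz_single hu i⟩
    simpa [extPair, funPair_zero_right, opPair_zero_right, sum_funPair_single]
      using h.extPair_eq h' hv

end Uniqueness

/-! ### Velocities -/

section Velocities

variable {m N : ℕ} {J : Set ℝ} {x : ℝ → Triple N} {v : Triple N} {t : ℝ}

theorem hasDerivWithinAt_dressSum {f g : ℝ → Fin N → LatticeFun} {α β : Fin N → LatticeFun}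
    (hf : ∀ i n y, HasDerivWithinAt (fun s => f s i n y) (α i n y) J t)
    (hg : ∀ i n y, HasDerivWithinAt (fun s => g s i n y) (β i n y) J t) (j n : ℤ) (y : ℝ) :
    HasDerivWithinAt (fun s => dressSum (f s) (g s) j n y)
      ((∑ i, (dress (α i) (g t i) + dress (f t i) (β i))) j n y) J t := by
  simp only [dressSum, Finset.sum_apply]
  refine HasDerivWithinAt.fun_sum fun i _ => ?_
  simp only [Pi.add_apply, dress]
  split_ifs with hj
  · exact (hf i n y).mul (hg i (n + j) y)
  · rw [add_zero]
    exact hasDerivWithinAt_const _ _ _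

/-- `B'` is the derivative of `B`: it relates the velocities of a curve and of its image. -/
theorem hasVelocity_backlund_iff : HasVelocity J (fun s => backlund (x s))
    (backlundDeriv (x t) v) t ↔ HasVelocity J x v t := by
  constructor
  · intro h
    refine ⟨fun j n y => ?_, h.2.1, h.2.2⟩
    -- The velocities of f and f* are already known, so the derivative of the dressing can be
    -- subtracted.
    have := (h.1 j n y).fun_sub (hasDerivWithinAt_dressSum h.2.1 h.2.2 j n y)
    simpa [backlund, backlundDeriv] using this
  · intro h
    refine ⟨fun j n y => ?_, h.2.1, h.2.2⟩
    exact (h.1 j n y).add (hasDerivWithinAt_dressSum h.2.1 h.2.2 j n y)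

theorem IsCurve.hasVelocity {σ : ℝ → Triple N} (hσ : IsCurve m σ) (x : Triple N) (t : ℝ) :
    HasVelocity Set.univ (fun s => x + σ s) (extVel σ t) t :=
  ⟨fun j n y => (((hσ.1.2 j).hasDerivAt t n y).const_add (x.1 j n y)).hasDerivWithinAt,
    fun i n y => (((hσ.2.1 i).hasDerivAt t n y).const_add (x.2.1 i n y)).hasDerivWithinAt,
    fun i n y => (((hσ.2.2 i).hasDerivAt t n y).const_add (x.2.2 i n y)).hasDerivWithinAt⟩

theorem hasVelocity_line (x v : Triple N) (t : ℝ) :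
    HasVelocity Set.univ (fun ε : ℝ => x + ε • v) v t := by
  have h (a b : ℂ) : HasDerivWithinAt (fun ε : ℝ => a + ε • b) b Set.univ t := by
    have := (((hasDerivAt_id t).smul_const b).const_add a).hasDerivWithinAt (s := Set.univ)
    rwa [one_smul] at this
  exact ⟨fun j n y => h _ _, fun i n y => h _ _, fun i n y => h _ _⟩

theorem IsCurve.isTangent_extVel {σ : ℝ → Triple N} (hσ : IsCurve m σ) :
    IsTangent m (extVel σ 0) := by
  refine ⟨⟨fun j hj => ?_, fun j => (hσ.1.2 j).vel_isSchwartz⟩,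
    fun i => (hσ.2.1 i).vel_isSchwartz, fun i => (hσ.2.2 i).vel_isSchwartz⟩
  funext n y
  have : (fun s => (σ s).1 j n y) = fun _ => 0 := funext fun s =>
    congrFun₂ (hσ.1.1 s j hj) n y
  change deriv (fun s => (σ s).1 j n y) 0 = 0
  rw [this, deriv_const]

end Velocities

/-! ### Curves under the Bäcklund transformation -/

section CurveImages

variable {m N : ℕ}

theorem IsOpCurve.add {σ τ : ℝ → ShiftOp} (hσ : IsOpCurve m σ) (hτ : IsOpCurve m τ) :
    IsOpCurve m (fun t => σ t + τ t) :=
  ⟨fun t j hj => by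
      change σ t j + τ t j = 0
      rw [hσ.1 t j hj, hτ.1 t j hj, add_zero],
    fun j => (hσ.2 j).add (hτ.2 j)⟩

theorem IsOpCurve.sum {ι : Type*} (s : Finset ι) {σ : ι → ℝ → ShiftOp}
    (h : ∀ i, IsOpCurve m (σ i)) : IsOpCurve m (fun t => ∑ i ∈ s, σ i t) := by
  refine ⟨fun t j hj => ?_, fun j => ?_⟩
  · refine (Finset.sum_apply _ _ _).trans ?_
    exact Finset.sum_eq_zero fun i _ => (h i).1 t j hj
  · simp only [Finset.sum_apply]
    exact .sum fun i _ => (h i).2 j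

theorem isOpCurve_dress (hm : 1 ≤ m) {φ ψ : ℝ → LatticeFun}
    (h : ∀ j : ℤ, IsSmoothCurve fun t n y => φ t n y * ψ t (n + j) y) :
    IsOpCurve m (fun t => dress (φ t) (ψ t)) := by
  refine ⟨fun t j hj => dress_of_pos _ _ (by omega), fun j => ?_⟩
  by_cases hj : j ≤ 0
  · have e : (fun t => dress (φ t) (ψ t) j) = fun t n y => φ t n y * ψ t (n + j) y := by
      funext t n y
      simp [dress, hj]
    rw [e]
    exact h j
  · have e : (fun t => dress (φ t) (ψ t) j) = fun _ => 0 :=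
      funext fun t => dress_of_pos _ _ (not_le.1 hj)
    rw [e]
    exact isSmoothCurve_zero

theorem dress_add_add (f g α β : LatticeFun) :
    dress (f + α) (g + β) = dress f g + (dress f β + dress α g + dress α β) := by
  funext j n y
  by_cases h : j ≤ 0
  · simp [dress, h]
    ring
  · simp [dress, h]

/-- Curves in the extended phase space are mapped by `B` to curves of operators. -/
theorem IsCurve.exists_isOpCurve_backlund (hm : 1 ≤ m) {σ : ℝ → Triple N} (hσ : IsCurve m σ)
    {x : Triple N} (hx : ∀ i, IsTempered (x.2.1 i)) (hx' : ∀ i, IsTempered (x.2.2 i)) :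
    ∃ τ, IsOpCurve m τ ∧ ∀ t, (backlund (x + σ t)).1 = (backlund x).1 + τ t := by
  -- The constant dressing stays in the base point; by bilinearity every remaining product has a
  -- Schwartz factor from the variation.
  refine ⟨fun t => (σ t).1 + ∑ i, (dress (x.2.1 i) ((σ t).2.2 i)
    + dress ((σ t).2.1 i) (x.2.2 i) + dress ((σ t).2.1 i) ((σ t).2.2 i)), ?_, fun t => ?_⟩
  · refine hσ.1.add (.sum _ fun i => ((isOpCurve_dress hm fun j => ?_).add
      (isOpCurve_dress hm fun j => ?_)).add (isOpCurve_dress hm fun j => ?_))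
    · exact (hx i).isTemperedCurve.mul_isSmoothCurve ((hσ.2.2 i).shift j)
    · have := ((hx' i).shift j).isTemperedCurve.mul_isSmoothCurve (hσ.2.1 i)
      simpa only [mul_comm] using this
    · exact (hσ.2.1 i).isTemperedCurve.mul_isSmoothCurve ((hσ.2.2 i).shift j)
  · have e : dressSum (x + σ t).2.1 (x + σ t).2.2 = dressSum x.2.1 x.2.2 +
        ∑ i, (dress (x.2.1 i) ((σ t).2.2 i) + dress ((σ t).2.1 i) (x.2.2 i)
          + dress ((σ t).2.1 i) ((σ t).2.2 i)) := by
      rw [dressSum, dressSum, ← Finset.sum_add_distrib]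
      exact Finset.sum_congr rfl fun i _ => dress_add_add _ _ _ _
    simp only [backlund]
    rw [e, Prod.fst_add]
    abel

end CurveImages

/-! ### The extended phase space -/

section PhaseSpace

variable {m N : ℕ} {c : ℂ} {γ : ShiftOp → ℂ} {dγ : ShiftOp → ShiftOp} {x z W w : Triple N}

/-- Since m ≥ 1, terms of order at most zero leave the leading coefficient untouched. -/
theorem add_mem_Ghat (hm : 1 ≤ m) {l D : ShiftOp} (hl : l ∈ Ghat m)
    (hD : ∀ j, 0 < j → D j = 0) (hs : ∀ j, IsSchwartz (D j)) : l + D ∈ Ghat m := by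
  refine ⟨?_, fun j hj => ?_, fun j hj => (hl.2.2 j hj).add (hs j)⟩
  · rw [Pi.add_apply, hl.1, hD _ (by omega), add_zero]
  · rw [Pi.add_apply, hl.2.1 j hj, hD _ (by omega), add_zero]

theorem backlund_mem_Phase (hm : 1 ≤ m) (hx : x ∈ Phase m N) : backlund x ∈ Phase m N :=
  ⟨add_mem_Ghat hm hx.1 (fun _ => dressSum_of_pos _ _) hx.2.2.2, hx.2⟩

theorem backlundInv_mem_Phase (hm : 1 ≤ m) (hx : x ∈ Phase m N) : backlundInv x ∈ Phase m N := by
  refine ⟨?_, hx.2⟩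
  simp only [backlundInv, sub_eq_add_neg]
  refine add_mem_Ghat hm hx.1 (fun j hj => ?_) fun j => (hx.2.2.2 j).neg
  rw [Pi.neg_apply, dressSum_of_pos _ _ hj, neg_zero]

theorem backlundInv_backlund (x : Triple N) : backlundInv (backlund x) = x := by
  simp [backlundInv, backlund]

theorem backlund_backlundInv (x : Triple N) : backlund (backlundInv x) = x := by
  simp [backlundInv, backlund]

/-- The Schwartz condition on the dressing involves only f and f*, so it survives B and its inverse.
-/
theorem bijOn_backlund (hm : 1 ≤ m) :
    Set.BijOn (backlund (N := N)) (Phase m N) (Phase m N) :=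
  ⟨fun _ => backlund_mem_Phase hm,
    (Function.LeftInverse.injective backlundInv_backlund).injOn,
    fun z hz => ⟨backlundInv z, backlundInv_mem_Phase hm hz, backlund_backlundInv z⟩⟩

theorem isTempered_of_mem_Phase (hx : x ∈ Phase m N) (i : Fin N) : IsTempered (x.2.1 i) :=
  (hx.2.1 i).1

theorem isTempered_of_mem_Phase' (hx : x ∈ Phase m N) (i : Fin N) : IsTempered (x.2.2 i) :=
  (hx.2.2.1 i).1

/-! ### Gradients of Casimir functionals -/

theorem IsCasimir.isGradientAt_fst (hγ : IsCasimir c m γ dγ) (hz : z ∈ Phase m N) :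
    IsGradientAt m (fun z : Triple N => γ z.1) z (dγ z.1, 0, 0) := by
  have hg := hγ.gradient z.1 hz.1
  refine ⟨⟨hg.1, fun _ => isTempered_zero, fun _ => isTempered_zero⟩, fun σ hσ h0 => ?_⟩
  have := hg.2 _ hσ.1 (by rw [h0]; rfl)
  simpa [extPair, funPair_zero_left, extVel] using this

/-- The gradient of `γ ∘ B` is the image of `(dγ, 0, 0)` under the conjugate operator `B'*`. -/
theorem IsCasimir.isGradientAt_backlund (hm : 1 ≤ m) (hγ : IsCasimir c m γ dγ)
    (hx : x ∈ Phase m N) :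
    IsGradientAt m (fun x : Triple N => γ (backlund x).1) x
      (dγ (backlund x).1,
        fun i => act (adj (plusPart (dγ (backlund x).1))) (x.2.2 i),
        fun i => act (plusPart (dγ (backlund x).1)) (x.2.1 i)) := by
  have hf := isTempered_of_mem_Phase hx
  have hg := isTempered_of_mem_Phase' hx
  have hd := hγ.gradient _ (backlund_mem_Phase hm hx).1
  set A := dγ (backlund x).1 with hA
  refine ⟨⟨hd.1, fun i => hd.1.isTempered_act_adj (hg i), fun i => hd.1.isTempered_act (hf i)⟩,
    fun σ hσ h0 => ?_⟩
  obtain ⟨τ, hτ, e⟩ := hσ.exists_isOpCurve_backlund hm hf hg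
  have hτ0 : τ 0 = 0 := by
    have := e 0
    rwa [h0, add_zero, left_eq_add] at this
  -- τ differs by a constant from the operator component of the image curve, so the two have the
  -- same velocity.
  have hv : (fun j => vel (fun t => τ t j) 0) = (backlundDeriv x (extVel σ 0)).1 := by
    have h1 := hasVelocity_backlund_iff.2 (hσ.hasVelocity x 0)
    rw [h0, add_zero] at h1
    funext j n y
    have h2 := (h1.1 j n y).hasDerivAt Filter.univ_mem
    simp only [e, Pi.add_apply] at h2
    exact ((hasDerivAt_const_add_iff _).1 h2).deriv
  have hderiv := hd.2 τ hτ hτ0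
  rw [hv] at hderiv
  have hconj := extPair_backlundDeriv hm hf hg hσ.isTangent_extVel (w := (A, 0, 0))
    ⟨hd.1, fun _ => isTempered_zero, fun _ => isTempered_zero⟩
  simp only [e]
  convert hderiv using 1
  have h3 : backlundConj x (A, 0, 0) = (A, fun i => act (adj (plusPart A)) (x.2.2 i),
      fun i => act (plusPart A) (x.2.1 i)) := by
    simp [backlundConj]
  rw [← h3, ← hconj]
  simp [extPair, funPair_zero_left]

theorem IsCasimir.isSmoothFunctional_backlund (hm : 1 ≤ m) (hγ : IsCasimir c m γ dγ) :
    IsSmoothFunctional m (fun x : Triple N => γ (backlund x).1) := by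
  refine fun x hx => ⟨fun σ hσ => ?_, _, hγ.isGradientAt_backlund hm hx⟩
  obtain ⟨τ, hτ, e⟩ := hσ.exists_isOpCurve_backlund hm (isTempered_of_mem_Phase hx)
    (isTempered_of_mem_Phase' hx)
  simp only [e]
  exact (hγ.smooth _ (backlund_mem_Phase hm hx).1).1 τ hτ

/-! ### Equality of the vector fields -/

/-- The Hamiltonian vector field of `γ` is given by the Lax equation. -/
theorem IsCasimir.neg_theta_eq_laxField (hm : 1 ≤ m) (hγ : IsCasimir c m γ dγ)
    (hx : x ∈ Phase m N)
    (hW : IsGradientAt m (fun z : Triple N => γ z.1) (backlund x) W) :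
    -theta c (backlund x) W = laxField c (dγ (backlund x).1) (backlund x) := by
  have hz := backlund_mem_Phase hm hx
  have hG := hγ.isGradientAt_fst hz
  have hcoeff := hW.coeff_eq hG
  have hsnd : W.2 = 0 := hW.snd_eq hG
  have hp := plusPart_congr hm hcoeff
  have hA : IsOrderBounded (dγ (backlund x).1) := (hγ.gradient _ hz.1).1.1
  have key := thetaOp_add_dress_eq_centralComm c x.2.1 x.2.2
    (⟨m, hx.1.2.1⟩ : IsOrderBounded x.1) hA (hγ.invariant _ hz.1)
  rw [theta, backlundInv_backlund]
  simp only [backlundConj, thetaTilde, backlundDeriv, laxField, hsnd,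
    thetaOp_congr c hm hx.1.2.1 hcoeff, hp]
  refine Prod.ext ?_ (Prod.ext ?_ ?_)
  · refine congrArg Neg.neg ?_
    refine Eq.trans ?_ key
    simp [Pi.neg_def]
  · funext i
    simp [backlund]
  · funext i
    simp [backlund]

/-- The transformed vector field is the Hamiltonian field of `γ ∘ B` for `Θ̃`. -/
theorem IsCasimir.backlundDeriv_transformedField (hm : 1 ≤ m) (hγ : IsCasimir c m γ dγ)
    (hx : x ∈ Phase m N)
    (hW : IsGradientAt m (fun z : Triple N => γ z.1) (backlund x) W)
    (hw : IsGradientAt m (fun x : Triple N => γ (backlund x).1) x w) :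
    -theta c (backlund x) W = backlundDeriv x (transformedField c w x) := by
  have hz := backlund_mem_Phase hm hx
  have hG := hγ.isGradientAt_fst hz
  have hG' := hγ.isGradientAt_backlund hm hx
  have hsnd : W.2 = 0 := hW.snd_eq hG
  have hp := plusPart_congr hm (hW.coeff_eq hG)
  have hcoeff : ∀ j : ℤ, -(m : ℤ) < j → W.1 j = w.1 j := fun j hj =>
    (hW.coeff_eq hG j hj).trans (hw.coeff_eq hG' j hj).symm
  have hconj : (backlundConj x W).2 = w.2 := by
    rw [hw.snd_eq hG']
    simp [backlundConj, hsnd, hp]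
  -- `w` and B'*`W` share their function components and their operator coefficients above order -m,
  -- which is all that Θ̃ sees.
  have hfield : transformedField c w x = -thetaTilde c x (backlundConj x W) := by
    refine Prod.ext ?_ (Prod.ext ?_ ?_)
    · refine (neg_thetaOp c x.1 w.1).symm.trans (congrArg Neg.neg ?_)
      exact (thetaOp_congr c hm hx.1.2.1 hcoeff).symm
    · simp [transformedField, thetaTilde, hconj]
    · simp [transformedField, thetaTilde, hconj]
  have hneg : ∀ v : Triple N, backlundDeriv x (-v) = -backlundDeriv x v := fun v => by
    have h1 (f g : LatticeFun) : dress f (-g) = -dress f g := by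
      funext j n y
      by_cases h : j ≤ 0 <;> simp [dress, h]
    refine Prod.ext ?_ rfl
    simp only [backlundDeriv, Prod.fst_neg, Prod.snd_neg, Pi.neg_apply, h1, dress_neg_left,
      ← neg_add, Finset.sum_neg_distrib]
  rw [hfield, hneg, theta, backlundInv_backlund]

end PhaseSpace

end ShiftLax

theorem theorem5 (N m : ℕ) (hm : 1 ≤ m) (c : ℂ) (γ : ShiftOp → ℂ) (dγ : ShiftOp → ShiftOp)
    (hγ : IsCasimir c m γ dγ) :
    -- `B` is a bijection of the extended phase space, with derivative `B'` and conjugate `B'*`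
    (Set.BijOn (backlund (N := N)) (Phase m N) (Phase m N) ∧
      (∀ x ∈ Phase m N, ∀ v : Triple N, IsTangent m v →
        HasVelocity Set.univ (fun ε : ℝ => backlund (x + ε • v)) (backlundDeriv x v) 0) ∧
      (∀ x ∈ Phase m N, ∀ v w : Triple N, IsTangent m v → IsCovector w →
        extPair w (backlundDeriv x v) = extPair (backlundConj x w) v)) ∧
    -- gradients of the functional on both sides of the transformation; the pulled back functional
    -- is smooth
    (∀ z ∈ Phase m N, IsGradientAt m (fun z : Triple N => γ z.1) z (dγ z.1, 0, 0)) ∧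
    IsSmoothFunctional m (fun x : Triple N => γ (backlund x).1) ∧
    (∀ x ∈ Phase m N, IsGradientAt m (fun x : Triple N => γ (backlund x).1) x
      (dγ (backlund x).1,
        fun i => act (adj (plusPart (dγ (backlund x).1))) (x.2.2 i),
        fun i => act (plusPart (dγ (backlund x).1)) (x.2.1 i))) ∧
    -- equivalence of the evolution systems, whatever representatives of the gradients are used
    ∀ (J : Set ℝ) (x : ℝ → Triple N), (∀ t ∈ J, x t ∈ Phase m N) →
      ∀ W : ℝ → Triple N,
        (∀ t ∈ J, IsGradientAt m (fun z : Triple N => γ z.1) (backlund (x t)) (W t)) →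
      ∀ w : ℝ → Triple N,
        (∀ t ∈ J, IsGradientAt m (fun x : Triple N => γ (backlund x).1) (x t) (w t)) →
      ((∀ t ∈ J, HasVelocity J (fun s => backlund (x s))
          (-theta c (backlund (x t)) (W t)) t) ↔
        ∀ t ∈ J, HasVelocity J (fun s => backlund (x s))
          (laxField c (dγ (backlund (x t)).1) (backlund (x t))) t) ∧
      ((∀ t ∈ J, HasVelocity J (fun s => backlund (x s))
          (-theta c (backlund (x t)) (W t)) t) ↔
        ∀ t ∈ J, HasVelocity J x (transformedField c (w t) (x t)) t) := by
  refine ⟨⟨bijOn_backlund hm, fun x _ v _ => ?_, fun x hx v w hv hw => ?_⟩,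
    fun z hz => hγ.isGradientAt_fst hz, hγ.isSmoothFunctional_backlund hm,
    fun x hx => hγ.isGradientAt_backlund hm hx, fun J x hx W hW w hw => ⟨?_, ?_⟩⟩
  · have h := hasVelocity_backlund_iff.2 (hasVelocity_line x v 0)
    rwa [zero_smul, add_zero] at h
  · exact extPair_backlundDeriv hm (isTempered_of_mem_Phase hx) (isTempered_of_mem_Phase' hx) hv hw
  -- Both equivalences hold separately at each time: here the two fields coincide, and in the next
  -- one they correspond under B'.
  · refine forall₂_congr fun t ht => ?_
    rw [hγ.neg_theta_eq_laxField hm (hx t ht) (hW t ht)]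
  · refine forall₂_congr fun t ht => ?_
    rw [hγ.backlundDeriv_transformedField hm (hx t ht) (hW t ht) (hw t ht),
      hasVelocity_backlund_iff]
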